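/- A seller sells a single item in $S$ seasons of $T$ periods each, starting every season with inventory $n_0\ge 0$. In each period the seller offers one of $K\ge 2$ prices $p_1,\dots,p_K\ge 0$ or a shut-off price under which demand is zero. Given a parameter $\theta\in\Theta$, the demand in period $t$ under price $p_k$ has distribution $\mathcal D_{t,k}(\theta)$ and is independent of the past given the offered price; the dependence on $\theta$ is an arbitrary measurable one, so that demands of different prices and periods may share parameters. If the demand is $D_{t;s}$ and the current inventory of season $s$ is $n_{t-1;s}$ (with $n_{0;s}=n_0$), the revenue is $P_{t;s}\min(D_{t;s},n_{t-1;s})$ and $n_{t;s}=\max(n_{t-1;s}-D_{t;s},0)$. The seller does not know $\theta$; it is drawn from a prior probability distribution $f$ on $\Theta$. Let $\lambda_{t,k}(\theta)$ be the mean of $\mathcal D_{t,k}(\theta)$, and let $x(\theta)=(x_{t,k}(\theta))$ be an optimal solution (chosen measurably in $\theta$) of the linear program: maximize $\sum_{t,k}x_{t,k}\lambda_{t,k}(\theta)p_k$ over $x\in[0,1]^{TK}$ subject to $\sum_{t,k}x_{t,k}\lambda_{t,k}(\theta)\le n_0$ and $\sum_k x_{t,k}\le 1$ for every $t$. The algorithm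 TS-episodic, at the start of each season $s$, draws $\theta_s$ from the posterior distribution of $\theta$ given all offers and demands of the earlier seasons, and then in each period $t$ of the season offers $p_k$ with probability $x_{t,k}(\theta_s)$ and the shut-off price with probability $1-\sum_k x_{t,k}(\theta_s)$. Its Bayesian regret is $$\mathrm{BRegret}=\mathbb E_{\theta\sim f}\bigl[S\,\mathrm{Rev}^*(\theta)-\mathrm{Rev}(\theta)\bigr],$$ where $\mathrm{Rev}^*(\theta)$ is the optimal expected revenue of one season over all (randomized, history-dependent) pricing policies that know $\theta$, and $\mathrm{Rev}(\theta)$ is the expected total revenue of TS-episodic over the $S$ seasons given $\theta$. Assume that $4K\le S$ and that there is $\bar d>0$ such that for all $t$, $k$, $\theta$ the support of $\mathcal D_{t,k}(\theta)$ is finite and contained in $[0,\bar d]$. Then the Bayesian regret is well defined (its integrand is integrable with respect to $f$), and $$\mathrm{BRegret}\le p_M\,\bar d\,\Bigl(S\sqrt T+54\,T\sqrt{SK\log K}\Bigr),\qquad p_M=\max_{1\le k\le K}p_k .$$ -/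

import Mathlib

open MeasureTheory ProbabilityTheory

open scoped BigOperators

namespace EpisodicRM

/-- The action of the seller in one period: `some k` offers the feasible price number `k`,
`none` offers the shut-off price. -/
abbrev Offer (K : ℕ) : Type := Option (Fin K)

instance instMeasurableSpaceOffer (K : ℕ) : MeasurableSpace (Offer K) := ⊤

instance instDiscreteMeasurableSpaceOffer (K : ℕ) : DiscreteMeasurableSpace (Offer K) :=
  ⟨fun _ => trivial⟩

/-- What is observed in one period: the offer and the realized demand. -/
abbrev Obs (K : ℕ) : Type := Offer K × ℝ

/-- The observations of the first `t` periods of a selling season. -/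
abbrev Past (K t : ℕ) : Type := Fin t → Obs K

/-- The history of the first `s` complete seasons of `T` periods each. -/
abbrev History (K T s : ℕ) : Type := Fin s → Past K T

/-- Appending one more entry to a finite sequence. -/
def append {α : Type*} {t : ℕ} (q : (Fin t → α) × α) : Fin (t + 1) → α :=
  Fin.snoc (α := fun _ => α) q.1 q.2

theorem measurable_append {α : Type*} [MeasurableSpace α] {t : ℕ} :
    Measurable (append : (Fin t → α) × α → Fin (t + 1) → α) := by
  refine measurable_pi_lambda _ fun i => ?_
  refine Fin.lastCases ?_ (fun j => ?_) i
  · simpa [append] using measurable_snd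
  · simpa [append, Function.comp_def] using (measurable_pi_apply j).comp measurable_fst

/-- The primitives of the single-item revenue management problem with `K` feasible prices and
seasons of `T` periods: the prices, the initial inventory of each season, and for each period `t`
and price `k` the demand distribution as a function of the unknown parameter `θ : Θ`.
Demands of different periods and prices share the parameter, in an arbitrary way. -/
structure Model (Θ : Type*) [MeasurableSpace Θ] (K T : ℕ) where
  /-- the feasible prices -/
  price : Fin K → ℝ
  price_nonneg : ∀ k, 0 ≤ price k
  /-- the inventory at the start of each season -/
  n₀ : ℝ
  n₀_nonneg : 0 ≤ n₀
  /-- the demand distribution in period `t` under price number `k`, given the parameter -/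
  demand : Fin T → Fin K → Kernel Θ ℝ
  demand_markov : ∀ t k, IsMarkovKernel (demand t k)

/-- A pricing policy for one season that is informed by a parameter value: in period `t` it draws
an offer at random, depending on that parameter value and on the current season so far. -/
structure SeasonPolicy (Θ : Type*) [MeasurableSpace Θ] (K T : ℕ) where
  /-- the conditional distribution of the offer of period `t` -/
  offer : (t : Fin T) → Kernel (Θ × Past K t) (Offer K)
  offer_markov : ∀ t, IsMarkovKernel (offer t)

namespace Model

variable {Θ : Type*} [MeasurableSpace Θ] {K T : ℕ}

/-- The distribution of the demand of period `t`, given the parameter and the offer: under the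
shut-off price the demand is zero. -/
noncomputable def offerDemand (M : Model Θ K T) (t : Fin T) : Kernel (Θ × Offer K) ℝ where
  toFun q := match q.2 with
    | none => Measure.dirac 0
    | some k => M.demand t k q.1
  measurable' := by
    refine measurable_from_prod_countable_left fun o => ?_
    cases o with
    | none => exact measurable_const
    | some k => exact (M.demand t k).measurable

/-- The mean demand `λ_{t,k}(θ)`. -/
noncomputable def meanDemand (M : Model Θ K T) (θ : Θ) (t : Fin T) (k : Fin K) : ℝ :=
  ∫ d, d ∂(M.demand t k θ)

/-- The price that an offer stands for. The value at the shut-off price is immaterial, since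
nothing is sold then. -/
def offerPrice (M : Model Θ K T) : Offer K → ℝ
  | none => 0
  | some k => M.price k

/-- The inventory left after the first `t` periods of a season. -/
noncomputable def inventory (M : Model Θ K T) : (t : ℕ) → Past K t → ℝ
  | 0, _ => M.n₀
  | t + 1, h => max (M.inventory t (Fin.init h) - (h (Fin.last t)).2) 0

/-- The revenue of the first `t` periods of a season: in each period the sales are the smaller
one of the demand and the inventory left. -/
noncomputable def revenue (M : Model Θ K T) : (t : ℕ) → Past K t → ℝ
  | 0, _ => 0
  | t + 1, h => M.revenue t (Fin.init h) +
      M.offerPrice (h (Fin.last t)).1 * min (h (Fin.last t)).2 (M.inventory t (Fin.init h))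

/-- One period under the policy `π`. The argument `((θ, θ'), h)` consists of the true parameter
`θ`, the parameter value `θ'` given to the policy, and the current season so far, `h`.
The policy draws the offer from `(θ', h)`, and the demand is then drawn from its distribution
under `θ` and that offer. -/
noncomputable def periodKernel (M : Model Θ K T) (π : SeasonPolicy Θ K T) (t : ℕ)
    (ht : t < T) : Kernel ((Θ × Θ) × Past K t) (Obs K) :=
  (π.offer ⟨t, ht⟩).comap (fun q : (Θ × Θ) × Past K t => (q.1.2, q.2)) (by fun_prop) ⊗ₖ
    (M.offerDemand ⟨t, ht⟩).comap
      (fun q : ((Θ × Θ) × Past K t) × Offer K => (q.1.1.1, q.2)) (by fun_prop)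

/-- The joint distribution of the first `t` periods of a season under the policy `π`, as a
function of the true parameter and of the parameter value given to the policy. -/
noncomputable def seasonKernel (M : Model Θ K T) (π : SeasonPolicy Θ K T) :
    (t : ℕ) → t ≤ T → Kernel (Θ × Θ) (Past K t)
  | 0, _ => Kernel.const (Θ × Θ) (Measure.dirac Fin.elim0)
  | t + 1, ht =>
    (M.seasonKernel π t (Nat.le_of_succ_le ht) ⊗ₖ M.periodKernel π t ht).map append

/-- The optimal expected revenue of one season when the parameter `θ` is known: the supremum of
the expected revenue over all policies (randomized and dependent on the season so far) that are
informed of `θ`. -/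
noncomputable def optRevenue (M : Model Θ K T) (θ : Θ) : ℝ :=
  ⨆ π : SeasonPolicy Θ K T, ∫ h, M.revenue T h ∂(M.seasonKernel π T le_rfl (θ, θ))

/-- Feasibility of `x` in the linear program with parameter `θ` and inventory `n` over the whole
season. -/
def LPFeasible (M : Model Θ K T) (θ : Θ) (n : ℝ) (x : Fin T → Fin K → ℝ) : Prop :=
  (∀ t k, x t k ∈ Set.Icc (0 : ℝ) 1) ∧
  ∑ t, ∑ k, x t k * M.meanDemand θ t k ≤ n ∧
  ∀ t, ∑ k, x t k ≤ 1

/-- The objective of the linear program. -/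
noncomputable def lpValue (M : Model Θ K T) (θ : Θ) (x : Fin T → Fin K → ℝ) : ℝ :=
  ∑ t, ∑ k, x t k * M.meanDemand θ t k * M.price k

/-- `x` is an optimal solution of the linear program. -/
def LPOptimal (M : Model Θ K T) (θ : Θ) (n : ℝ) (x : Fin T → Fin K → ℝ) : Prop :=
  M.LPFeasible θ n x ∧ ∀ y, M.LPFeasible θ n y → M.lpValue θ y ≤ M.lpValue θ x

end Model

/-- A solver of the linear program: a measurable choice of an optimal solution for every
parameter value, with the full initial inventory. -/
structure LPSolver {Θ : Type*} [MeasurableSpace Θ] {K T : ℕ} (M : Model Θ K T) where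
  /-- the optimal solution chosen at `θ` -/
  x : Θ → Fin T → Fin K → ℝ
  measurable_x : ∀ t k, Measurable fun θ => x θ t k
  optimal : ∀ θ, M.LPOptimal θ M.n₀ (x θ)

/-- The distribution on offers that offers price number `k` with probability `w k` and the
shut-off price with the remaining probability. -/
noncomputable def offerLaw {K : ℕ} (w : Fin K → ℝ) : Measure (Offer K) :=
  ∑ k, ENNReal.ofReal (w k) • Measure.dirac (some k) +
    ENNReal.ofReal (1 - ∑ k, w k) • Measure.dirac none

theorem isProbabilityMeasure_offerLaw {K : ℕ} {w : Fin K → ℝ} (h0 : ∀ k, 0 ≤ w k)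
    (h1 : ∑ k, w k ≤ 1) : IsProbabilityMeasure (offerLaw w) := by
  refine ⟨?_⟩
  simp only [offerLaw, Measure.add_apply, Measure.finsetSum_apply, Measure.smul_apply,
    measure_univ, smul_eq_mul, mul_one]
  rw [← ENNReal.ofReal_sum_of_nonneg fun k _ => h0 k,
    ← ENNReal.ofReal_add (Finset.sum_nonneg fun k _ => h0 k) (by linarith)]
  simp

theorem measurable_offerLaw {K : ℕ} : Measurable (offerLaw : (Fin K → ℝ) → Measure (Offer K)) := by
  refine Measure.measurable_of_measurable_coe _ fun s _ => ?_
  simp only [offerLaw, Measure.add_apply, Measure.finsetSum_apply, Measure.smul_apply, smul_eq_mul]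
  fun_prop

section PosteriorSampling

variable {Θ : Type*} [MeasurableSpace Θ] {K T : ℕ}

/-- The season policy of posterior sampling: given the sampled parameter `θ'`, offer in period
`t` price number `k` with probability `x_{t,k}(θ')`, and the shut-off price otherwise. -/
noncomputable def LPSolver.policy {M : Model Θ K T} (R : LPSolver M) : SeasonPolicy Θ K T where
  offer t :=
    { toFun := fun q => offerLaw (R.x q.1 t)
      measurable' := measurable_offerLaw.comp
        (measurable_pi_lambda _ fun k => (R.measurable_x t k).comp measurable_fst) }
  offer_markov t := ⟨fun q => isProbabilityMeasure_offerLaw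
    (fun k => ((R.optimal q.1).1.1 t k).1) ((R.optimal q.1).1.2.2 t)⟩

/-- One season of the algorithm. The argument is the true parameter `θ` together with the history
of the earlier seasons. A parameter `θ'` is drawn from `ρ` given the history only, the linear
program is solved for `θ'`, and the whole season is played with its solution. -/
noncomputable def tsSeasonKernel (M : Model Θ K T) (R : LPSolver M) {s : ℕ}
    (ρ : Kernel (History K T s) Θ) : Kernel (Θ × History K T s) (Past K T) :=
  M.seasonKernel R.policy T le_rfl ∘ₖ
    (Kernel.deterministic (Prod.fst : Θ × History K T s → Θ) measurable_fst ×ₖ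
      ρ.comap (Prod.snd : Θ × History K T s → History K T s) measurable_snd)

/-- The distribution of the history of the first `s` seasons, given the true parameter, when the
parameter of the season that follows a history `h` of `j` seasons is sampled from `ρ j h`. -/
noncomputable def tsHistoryKernel (M : Model Θ K T) (R : LPSolver M)
    (ρ : (s : ℕ) → Kernel (History K T s) Θ) : (s : ℕ) → Kernel Θ (History K T s)
  | 0 => Kernel.const Θ (Measure.dirac Fin.elim0)
  | s + 1 => (tsHistoryKernel M R ρ s ⊗ₖ tsSeasonKernel M R (ρ s)).map append

/-- `ρ` is (a version of) the posterior distribution of the parameter given the observation, for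
the prior `f` and the observation law `L`: drawing the parameter from `f` and then the observation
from `L` has the same joint distribution as drawing the observation from its marginal and then the
parameter from `ρ`. -/
def IsPosterior {X : Type*} [MeasurableSpace X] (f : Measure Θ) (L : Kernel Θ X)
    (ρ : Kernel X Θ) : Prop :=
  (f ⊗ₘ L).map Prod.swap = (L ∘ₘ f) ⊗ₘ ρ

/-- The episodic posterior sampling algorithm for the prior `f`, the solver `R` and `S` seasons:
at the start of each season the parameter is sampled from the posterior given the history that the
algorithm itself has generated. The algorithm is determined by the sampling kernels `ρ`. -/
structure TSEpisodic (M : Model Θ K T) (R : LPSolver M) (f : Measure Θ) (S : ℕ) where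
  /-- the distribution of the sampled parameter given the history of the first `s` seasons -/
  ρ : (s : ℕ) → Kernel (History K T s) Θ
  ρ_markov : ∀ s, IsMarkovKernel (ρ s)
  posterior : ∀ s, s < S → IsPosterior f (tsHistoryKernel M R ρ s) (ρ s)

variable {M : Model Θ K T} {R : LPSolver M} {f : Measure Θ} {S : ℕ}

/-- The expected total revenue of the algorithm over all `S` seasons, given the parameter. -/
noncomputable def TSEpisodic.expRevenue (A : TSEpisodic M R f S) (θ : Θ) : ℝ :=
  ∫ h, ∑ s, M.revenue T (h s) ∂(tsHistoryKernel M R A.ρ S θ)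

/-- The regret of the algorithm under the parameter `θ`. -/
noncomputable def TSEpisodic.regret (A : TSEpisodic M R f S) (θ : Θ) : ℝ :=
  S * M.optRevenue θ - A.expRevenue θ

/-- The Bayesian regret of the algorithm: the expected regret when the parameter follows the
prior. -/
noncomputable def TSEpisodic.bayesRegret (A : TSEpisodic M R f S) : ℝ :=
  ∫ θ, A.regret θ ∂f

end PosteriorSampling

end EpisodicRM

namespace EpisodicRM

/-- A real function that is measurable and bounded. -/
structure BoundedMeasurable {α : Type*} [MeasurableSpace α] (g : α → ℝ) : Prop where
  meas : Measurable g
  bdd : ∃ C, ∀ x, |g x| ≤ C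

namespace BoundedMeasurable

variable {α β : Type*} [MeasurableSpace α] [MeasurableSpace β] {g g' : α → ℝ}

theorem of_mem_Icc {a b : ℝ} (hg : Measurable g) (h : ∀ x, g x ∈ Set.Icc a b) :
    BoundedMeasurable g :=
  ⟨hg, max |a| |b|, fun x => abs_le_max_abs_abs (h x).1 (h x).2⟩

theorem const (c : ℝ) : BoundedMeasurable (fun _ : α => c) :=
  ⟨measurable_const, |c|, fun _ => le_rfl⟩

theorem add (h : BoundedMeasurable g) (h' : BoundedMeasurable g') :
    BoundedMeasurable (fun x => g x + g' x) := by
  obtain ⟨C, hC⟩ := h.bdd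
  obtain ⟨C', hC'⟩ := h'.bdd
  exact ⟨h.meas.add h'.meas, C + C', fun x => (abs_add_le _ _).trans (add_le_add (hC x) (hC' x))⟩

theorem mul (h : BoundedMeasurable g) (h' : BoundedMeasurable g') :
    BoundedMeasurable (fun x => g x * g' x) := by
  obtain ⟨C, hC⟩ := h.bdd
  obtain ⟨C', hC'⟩ := h'.bdd
  refine ⟨h.meas.mul h'.meas, C * C', fun x => ?_⟩
  rw [abs_mul]
  exact mul_le_mul (hC x) (hC' x) (abs_nonneg _) ((abs_nonneg _).trans (hC x))

theorem const_mul (c : ℝ) (h : BoundedMeasurable g) : BoundedMeasurable (fun x => c * g x) :=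
  (const c).mul h

theorem neg (h : BoundedMeasurable g) : BoundedMeasurable (fun x => -g x) := by
  simpa using h.const_mul (-1)

theorem sub (h : BoundedMeasurable g) (h' : BoundedMeasurable g') :
    BoundedMeasurable (fun x => g x - g' x) := by
  simpa [sub_eq_add_neg] using h.add h'.neg

theorem abs (h : BoundedMeasurable g) : BoundedMeasurable (fun x => |g x|) := by
  obtain ⟨C, hC⟩ := h.bdd
  exact ⟨h.meas.abs, C, fun x => by rw [abs_abs]; exact hC x⟩

theorem max (h : BoundedMeasurable g) (h' : BoundedMeasurable g') :
    BoundedMeasurable (fun x => max (g x) (g' x)) := by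
  obtain ⟨C, hC⟩ := h.bdd
  obtain ⟨C', hC'⟩ := h'.bdd
  exact ⟨h.meas.max h'.meas, Max.max C C', fun x =>
    abs_max_le_max_abs_abs.trans (max_le_max (hC x) (hC' x))⟩

theorem sum {ι : Type*} (s : Finset ι) {g : ι → α → ℝ}
    (h : ∀ i ∈ s, BoundedMeasurable (g i)) : BoundedMeasurable (fun x => ∑ i ∈ s, g i x) := by
  classical
  induction s using Finset.induction_on with
  | empty => simpa using const 0
  | insert a s ha ih =>
    simp only [Finset.sum_insert ha]
    exact (h a (Finset.mem_insert_self _ _)).add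
      (ih fun i hi => h i (Finset.mem_insert_of_mem hi))

theorem comp (h : BoundedMeasurable g) {φ : β → α} (hφ : Measurable φ) :
    BoundedMeasurable (fun x => g (φ x)) := by
  obtain ⟨C, hC⟩ := h.bdd
  exact ⟨h.meas.comp hφ, C, fun x => hC _⟩

theorem comp_continuous (h : BoundedMeasurable g) {F : ℝ → ℝ} (hF : Continuous F) :
    BoundedMeasurable (fun x => F (g x)) := by
  obtain ⟨C, hC⟩ := h.bdd
  obtain ⟨B, hB⟩ := (isCompact_Icc (a := -C) (b := C)).exists_bound_of_continuousOn
    hF.continuousOn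
  exact ⟨hF.measurable.comp h.meas, B, fun x => hB _ (abs_le.mp (hC x))⟩

theorem ite {p : α → Prop} [DecidablePred p] (hp : MeasurableSet {x | p x})
    (h : BoundedMeasurable g) (h' : BoundedMeasurable g') :
    BoundedMeasurable (fun x => if p x then g x else g' x) := by
  obtain ⟨C, hC⟩ := h.bdd
  obtain ⟨C', hC'⟩ := h'.bdd
  refine ⟨Measurable.ite hp h.meas h'.meas, Max.max C C', fun x => ?_⟩
  split_ifs
  · exact (hC x).trans (le_max_left _ _)
  · exact (hC' x).trans (le_max_right _ _)

theorem integrable (h : BoundedMeasurable g) (μ : Measure α) [IsFiniteMeasure μ] :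
    Integrable g μ := by
  obtain ⟨C, hC⟩ := h.bdd
  exact Integrable.of_bound h.meas.aestronglyMeasurable C (Filter.Eventually.of_forall hC)

theorem integral_mem_bound {μ : Measure α} [IsProbabilityMeasure μ] {C : ℝ}
    (hC : ∀ x, |g x| ≤ C) : |∫ x, g x ∂μ| ≤ C := by
  simpa using norm_integral_le_of_norm_le_const (μ := μ) (f := g) (C := C)
    (Filter.Eventually.of_forall hC)

theorem integral_kernel {g : α × β → ℝ} (h : BoundedMeasurable g) (κ : Kernel α β)
    [IsMarkovKernel κ] : BoundedMeasurable (fun a => ∫ b, g (a, b) ∂(κ a)) := by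
  obtain ⟨C, hC⟩ := h.bdd
  exact ⟨(h.meas.stronglyMeasurable.integral_kernel_prod_right (κ := κ)
    (f := fun a b => g (a, b))).measurable, C, fun a => integral_mem_bound fun b => hC _⟩

end BoundedMeasurable

theorem integral_kernel_compProd {α β γ : Type*} [MeasurableSpace α] [MeasurableSpace β]
    [MeasurableSpace γ] (κ : Kernel α β) [IsMarkovKernel κ] (η : Kernel (α × β) γ)
    [IsMarkovKernel η] {g : β × γ → ℝ} (hg : BoundedMeasurable g) (a : α) :
    ∫ z, g z ∂((κ ⊗ₖ η) a) = ∫ x, ∫ y, g (x, y) ∂(η (a, x)) ∂(κ a) :=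
  integral_compProd (hg.integrable _)

/-- A finite family of measurable functions has a measurable maximizer. -/
theorem exists_measurable_argmax {X ι : Type*} [MeasurableSpace X] [Fintype ι] [Nonempty ι]
    [MeasurableSpace ι] [DiscreteMeasurableSpace ι] (g : ι → X → ℝ) (hg : ∀ i, Measurable (g i)) :
    ∃ a : X → ι, Measurable a ∧ ∀ i x, g i x ≤ g (a x) x := by
  classical
  suffices H : ∀ s : Finset ι, ∃ a : X → ι, Measurable a ∧ ∀ i ∈ s, ∀ x, g i x ≤ g (a x) x by
    obtain ⟨a, ha, h⟩ := H Finset.univ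
    exact ⟨a, ha, fun i x => h i (Finset.mem_univ _) x⟩
  intro s
  induction s using Finset.induction_on with
  | empty => exact ⟨fun _ => Classical.arbitrary ι, measurable_const, by simp⟩
  | insert j s _ ih =>
    obtain ⟨a, ha, h⟩ := ih
    have hga : Measurable fun x => g (a x) x := by
      have : Measurable (fun q : ι × X => g q.1 q.2) :=
        measurable_from_prod_countable_right fun i => hg i
      exact this.comp (ha.prodMk measurable_id)
    refine ⟨fun x => if g (a x) x < g j x then j else a x,
      Measurable.ite (measurableSet_lt hga (hg j)) measurable_const ha, fun i hi x => ?_⟩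
    dsimp only
    rcases Finset.mem_insert.mp hi with rfl | hi
    · split_ifs with hx
      · exact le_rfl
      · exact not_lt.mp hx
    · split_ifs with hx
      · exact (h i hi x).trans hx.le
      · exact h i hi x

/-- The projection of a demand to `[0, d]`. -/
noncomputable def clip (d y : ℝ) : ℝ := max 0 (min y d)

theorem clip_nonneg (d y : ℝ) : 0 ≤ clip d y := le_max_left _ _

theorem clip_le {d : ℝ} (hd : 0 ≤ d) (y : ℝ) : clip d y ≤ d := max_le hd (min_le_right _ _)

theorem clip_of_mem {d y : ℝ} (h : y ∈ Set.Icc 0 d) : clip d y = y := by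
  rw [clip, min_eq_left h.2, max_eq_right h.1]

theorem measurable_clip (d : ℝ) : Measurable (clip d) := by
  unfold clip; fun_prop

theorem boundedMeasurable_clip {d : ℝ} (hd : 0 ≤ d) : BoundedMeasurable (clip d) :=
  .of_mem_Icc (measurable_clip d) fun y => ⟨clip_nonneg d y, clip_le hd y⟩

/-- The projection of all demands of a season to `[0, d]`. -/
noncomputable def clipPast {K t : ℕ} (d : ℝ) (h : Past K t) : Past K t :=
  fun i => ((h i).1, clip d (h i).2)

theorem measurable_clipPast {K t : ℕ} (d : ℝ) : Measurable (clipPast d : Past K t → Past K t) := by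
  have := measurable_clip d
  unfold clipPast
  fun_prop

theorem clipPast_append {K t : ℕ} (d : ℝ) (h : Past K t) (o : Obs K) :
    clipPast d (append (h, o)) = append (clipPast d h, (o.1, clip d o.2)) := by
  funext i
  refine Fin.lastCases ?_ (fun j => ?_) i <;> simp [clipPast, append]

@[simp] theorem append_last {α : Type*} {t : ℕ} (q : (Fin t → α) × α) :
    append q (Fin.last t) = q.2 := by simp [append]

@[simp] theorem append_castSucc {α : Type*} {t : ℕ} (q : (Fin t → α) × α) (i : Fin t) :
    append q i.castSucc = q.1 i := by simp [append]

@[simp] theorem init_append {α : Type*} {t : ℕ} (q : (Fin t → α) × α) :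
    Fin.init (append q) = q.1 := by
  funext i; simp [Fin.init]

variable {Θ : Type*} [MeasurableSpace Θ] {K T : ℕ}

namespace Model

instance isMarkovKernel_demand (M : Model Θ K T) (t : Fin T) (k : Fin K) :
    IsMarkovKernel (M.demand t k) := M.demand_markov t k

instance isMarkovKernel_offerDemand (M : Model Θ K T) (t : Fin T) :
    IsMarkovKernel (M.offerDemand t) := by
  refine ⟨fun q => ?_⟩
  obtain ⟨θ, o⟩ := q
  cases o with
  | none => exact (inferInstance : IsProbabilityMeasure (Measure.dirac (0 : ℝ)))
  | some k => exact (inferInstance : IsProbabilityMeasure (M.demand t k θ))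

instance isMarkovKernel_offer (π : SeasonPolicy Θ K T) (t : Fin T) :
    IsMarkovKernel (π.offer t) := π.offer_markov t

instance isMarkovKernel_periodKernel (M : Model Θ K T) (π : SeasonPolicy Θ K T) (t : ℕ)
    (ht : t < T) : IsMarkovKernel (M.periodKernel π t ht) := by
  have h1 : IsMarkovKernel ((π.offer ⟨t, ht⟩).comap
      (fun q : (Θ × Θ) × Past K t => (q.1.2, q.2)) (by fun_prop)) :=
    ⟨fun q => (π.offer_markov ⟨t, ht⟩).isProbabilityMeasure (q.1.2, q.2)⟩
  unfold periodKernel; infer_instance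

instance isMarkovKernel_seasonKernel (M : Model Θ K T) (π : SeasonPolicy Θ K T) (t : ℕ)
    (ht : t ≤ T) : IsMarkovKernel (M.seasonKernel π t ht) := by
  induction t with
  | zero => unfold seasonKernel; infer_instance
  | succ t ih =>
    have := ih (Nat.le_of_succ_le ht)
    exact Kernel.IsMarkovKernel.map _ measurable_append

theorem offerDemand_none (M : Model Θ K T) (t : Fin T) (θ : Θ) :
    M.offerDemand t (θ, none) = Measure.dirac 0 := rfl

theorem offerDemand_some (M : Model Θ K T) (t : Fin T) (θ : Θ) (k : Fin K) :
    M.offerDemand t (θ, some k) = M.demand t k θ := rfl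

theorem integral_periodKernel (M : Model Θ K T) (π : SeasonPolicy Θ K T) {t : ℕ} (ht : t < T)
    (p : Θ × Θ) (h : Past K t) {g : Obs K → ℝ} (hg : BoundedMeasurable g) :
    ∫ o, g o ∂(M.periodKernel π t ht (p, h)) =
      ∫ o, ∫ y, g (o, y) ∂(M.offerDemand ⟨t, ht⟩ (p.1, o)) ∂(π.offer ⟨t, ht⟩ (p.2, h)) := by
  have h1 : IsMarkovKernel ((π.offer ⟨t, ht⟩).comap
      (fun q : (Θ × Θ) × Past K t => (q.1.2, q.2)) (by fun_prop)) :=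
    ⟨fun q => (π.offer_markov ⟨t, ht⟩).isProbabilityMeasure (q.1.2, q.2)⟩
  rw [periodKernel, integral_kernel_compProd _ _ hg]
  simp [Kernel.comap_apply]

theorem integral_seasonKernel_zero (M : Model Θ K T) (π : SeasonPolicy Θ K T) (ht : 0 ≤ T)
    (p : Θ × Θ) (g : Past K 0 → ℝ) :
    ∫ h, g h ∂(M.seasonKernel π 0 ht p) = g Fin.elim0 := by
  have : ∀ h : Past K 0, h = Fin.elim0 := fun h => Subsingleton.elim _ _
  rw [integral_congr_ae (g := fun _ => g Fin.elim0)
    (Filter.Eventually.of_forall fun h => by rw [this h])]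
  simp

theorem integral_seasonKernel_succ (M : Model Θ K T) (π : SeasonPolicy Θ K T) {t : ℕ}
    (ht : t + 1 ≤ T) (p : Θ × Θ) {g : Past K (t + 1) → ℝ} (hg : BoundedMeasurable g) :
    ∫ h, g h ∂(M.seasonKernel π (t + 1) ht p) =
      ∫ h, ∫ o, ∫ y, g (append (h, (o, y))) ∂(M.offerDemand ⟨t, ht⟩ (p.1, o))
        ∂(π.offer ⟨t, ht⟩ (p.2, h)) ∂(M.seasonKernel π t (Nat.le_of_succ_le ht) p) := by
  have hga : BoundedMeasurable fun z : Past K t × Obs K => g (append z) :=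
    hg.comp measurable_append
  rw [seasonKernel, Kernel.map_apply _ measurable_append,
    integral_map measurable_append.aemeasurable hg.meas.aestronglyMeasurable,
    integral_kernel_compProd _ _ hga]
  refine integral_congr_ae (Filter.Eventually.of_forall fun h => ?_)
  exact M.integral_periodKernel π ht p h (hga.comp measurable_prodMk_left)

/-- All demands lie in `[0, d]`. -/
def DemandBounded (M : Model Θ K T) (d : ℝ) : Prop :=
  ∀ t k θ, ∀ᵐ y ∂(M.demand t k θ), y ∈ Set.Icc 0 d

theorem ae_offerDemand {M : Model Θ K T} {d : ℝ} (hd : 0 ≤ d) (hM : M.DemandBounded d)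
    (t : Fin T) (q : Θ × Offer K) : ∀ᵐ y ∂(M.offerDemand t q), y ∈ Set.Icc 0 d := by
  obtain ⟨θ, o⟩ := q
  cases o with
  | none =>
    rw [offerDemand_none]
    exact (ae_dirac_iff (p := fun y => y ∈ Set.Icc 0 d) measurableSet_Icc).2 ⟨le_rfl, hd⟩
  | some k => exact hM t k θ

theorem measurableSet_clipPast_eq {t : ℕ} (d : ℝ) :
    MeasurableSet {h : Past K t | clipPast d h = h} := by
  have : {h : Past K t | clipPast d h = h} = ⋂ i, {h : Past K t | clip d (h i).2 = (h i).2} := by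
    ext h
    simp only [Set.mem_ofPred_eq, Set.mem_iInter, funext_iff, clipPast, Prod.ext_iff, true_and]
  rw [this]
  have hc := measurable_clip d
  exact MeasurableSet.iInter fun i => measurableSet_eq_fun (by fun_prop) (by fun_prop)

theorem ae_clipPast_eq {M : Model Θ K T} {d : ℝ} (hd : 0 ≤ d) (hM : M.DemandBounded d)
    (π : SeasonPolicy Θ K T) (t : ℕ) (ht : t ≤ T) (p : Θ × Θ) :
    ∀ᵐ h ∂(M.seasonKernel π t ht p), clipPast d h = h := by
  induction t with
  | zero => exact Filter.Eventually.of_forall fun h => Subsingleton.elim _ _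
  | succ t ih =>
    rw [seasonKernel, Kernel.map_apply _ measurable_append,
      ae_map_iff measurable_append.aemeasurable (measurableSet_clipPast_eq d)]
    refine Kernel.ae_compProd_of_ae_ae (measurable_append (measurableSet_clipPast_eq d)) ?_
    filter_upwards [ih (Nat.le_of_succ_le ht)] with h hh
    rw [periodKernel]
    refine Kernel.ae_compProd_of_ae_ae ?_ (Filter.Eventually.of_forall fun o => ?_)
    · exact (measurable_append.comp measurable_prodMk_left) (measurableSet_clipPast_eq d)
    · rw [Kernel.comap_apply]
      filter_upwards [ae_offerDemand hd hM ⟨t, ht⟩ (p.1, o)] with y hy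
      rw [clipPast_append, hh, clip_of_mem hy]

end Model

end EpisodicRM

namespace EpisodicRM

theorem exists_boundedMeasurable_argmax {X ι : Type*} [MeasurableSpace X] [Fintype ι] [Nonempty ι]
    [MeasurableSpace ι] [DiscreteMeasurableSpace ι] (g : ι → X → ℝ)
    (hg : ∀ i, BoundedMeasurable (g i)) :
    ∃ a : X → ι, Measurable a ∧ BoundedMeasurable (fun x => g (a x) x) ∧
      ∀ i x, g i x ≤ g (a x) x := by
  obtain ⟨a, ha, h⟩ := exists_measurable_argmax g fun i => (hg i).meas
  refine ⟨a, ha, ⟨?_, ?_⟩, h⟩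
  · have : Measurable (fun q : ι × X => g q.1 q.2) :=
      measurable_from_prod_countable_right fun i => (hg i).meas
    exact this.comp (ha.prodMk measurable_id)
  · choose C hC using fun i => (hg i).bdd
    refine ⟨∑ i, |C i|, fun x => ((hC (a x) x).trans (le_abs_self _)).trans ?_⟩
    exact Finset.single_le_sum (f := fun i => |C i|) (fun i _ => abs_nonneg _) (Finset.mem_univ _)

namespace Model

variable {Θ : Type*} [MeasurableSpace Θ] {K T : ℕ}

theorem inventory_append (M : Model Θ K T) {t : ℕ} (h : Past K t) (o : Obs K) :
    M.inventory (t + 1) (append (h, o)) = max (M.inventory t h - o.2) 0 := by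
  simp [inventory]

theorem revenue_append (M : Model Θ K T) {t : ℕ} (h : Past K t) (o : Obs K) :
    M.revenue (t + 1) (append (h, o)) =
      M.revenue t h + M.offerPrice o.1 * min o.2 (M.inventory t h) := by
  simp [revenue]

theorem measurable_init {t : ℕ} :
    Measurable (fun h : Past K (t + 1) => (Fin.init h : Past K t)) :=
  measurable_pi_lambda _ fun i => measurable_pi_apply i.castSucc

theorem measurable_inventory (M : Model Θ K T) (t : ℕ) : Measurable (M.inventory t) := by
  induction t with
  | zero => exact measurable_const
  | succ t ih =>
    have := ih.comp (measurable_init (K := K) (t := t))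
    exact (this.sub (measurable_pi_apply (Fin.last t)).snd).max measurable_const

theorem measurable_offerPrice (M : Model Θ K T) : Measurable M.offerPrice :=
  measurable_of_countable _

theorem measurable_revenue (M : Model Θ K T) (t : ℕ) : Measurable (M.revenue t) := by
  induction t with
  | zero => exact measurable_const
  | succ t ih =>
    have h1 := ih.comp (measurable_init (K := K) (t := t))
    have h2 := (M.measurable_inventory t).comp (measurable_init (K := K) (t := t))
    exact h1.add ((M.measurable_offerPrice.comp (measurable_pi_apply (Fin.last t)).fst).mul
      ((measurable_pi_apply (Fin.last t)).snd.min h2))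

/-- The largest price. -/
noncomputable def maxPrice (M : Model Θ K T) : ℝ := ⨆ k, M.price k

theorem price_le_maxPrice (M : Model Θ K T) (k : Fin K) : M.price k ≤ M.maxPrice :=
  le_ciSup (f := M.price) (Set.finite_range _).bddAbove k

theorem maxPrice_nonneg (M : Model Θ K T) : 0 ≤ M.maxPrice :=
  Real.iSup_nonneg M.price_nonneg

theorem offerPrice_mem (M : Model Θ K T) (o : Offer K) : M.offerPrice o ∈ Set.Icc 0 M.maxPrice := by
  cases o with
  | none => exact ⟨le_rfl, M.maxPrice_nonneg⟩
  | some k => exact ⟨M.price_nonneg k, M.price_le_maxPrice k⟩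

/-- The inventory after a season with its demands projected to `[0, d]`. -/
noncomputable def clipInventory (M : Model Θ K T) (d : ℝ) (t : ℕ) (h : Past K t) : ℝ :=
  M.inventory t (clipPast d h)

/-- The revenue of a season with its demands projected to `[0, d]`. -/
noncomputable def clipRevenue (M : Model Θ K T) (d : ℝ) (t : ℕ) (h : Past K t) : ℝ :=
  M.revenue t (clipPast d h)

theorem clipInventory_append (M : Model Θ K T) (d : ℝ) {t : ℕ} (h : Past K t) (o : Obs K) :
    M.clipInventory d (t + 1) (append (h, o)) = max (M.clipInventory d t h - clip d o.2) 0 := by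
  simp only [clipInventory, clipPast_append, inventory_append]

theorem clipRevenue_append (M : Model Θ K T) (d : ℝ) {t : ℕ} (h : Past K t) (o : Obs K) :
    M.clipRevenue d (t + 1) (append (h, o)) = M.clipRevenue d t h +
      M.offerPrice o.1 * min (clip d o.2) (M.clipInventory d t h) := by
  simp only [clipRevenue, clipInventory, clipPast_append, revenue_append]

theorem exists_eq_append {α : Type*} {t : ℕ} (h : Fin (t + 1) → α) :
    ∃ (q : Fin t → α) (o : α), h = append (q, o) :=
  ⟨Fin.init h, h (Fin.last t), by simp [append]⟩

theorem clipInventory_mem (M : Model Θ K T) (d : ℝ) (t : ℕ) (h : Past K t) :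
    M.clipInventory d t h ∈ Set.Icc 0 M.n₀ := by
  induction t with
  | zero => exact ⟨M.n₀_nonneg, le_rfl⟩
  | succ t ih =>
    obtain ⟨q, o, rfl⟩ := exists_eq_append h
    rw [clipInventory_append]
    exact ⟨le_max_right _ _,
      max_le (by linarith [(ih q).2, clip_nonneg d o.2]) M.n₀_nonneg⟩

theorem clipRevenue_mem (M : Model Θ K T) {d : ℝ} (hd : 0 ≤ d) (t : ℕ) (h : Past K t) :
    M.clipRevenue d t h ∈ Set.Icc 0 (t * (M.maxPrice * d)) := by
  induction t with
  | zero => simp [clipRevenue, revenue]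
  | succ t ih =>
    obtain ⟨q, o, rfl⟩ := exists_eq_append h
    rw [clipRevenue_append]
    have h1 := M.offerPrice_mem o.1
    have h2 : 0 ≤ min (clip d o.2) (M.clipInventory d t q) :=
      le_min (clip_nonneg _ _) (M.clipInventory_mem d t q).1
    have h3 : min (clip d o.2) (M.clipInventory d t q) ≤ d :=
      (min_le_left _ _).trans (clip_le hd _)
    have h4 := ih q
    refine ⟨add_nonneg h4.1 (mul_nonneg h1.1 h2), ?_⟩
    have := mul_le_mul h1.2 h3 h2 M.maxPrice_nonneg
    push_cast
    linarith [h4.2]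

theorem boundedMeasurable_clipInventory (M : Model Θ K T) (d : ℝ) (t : ℕ) :
    BoundedMeasurable (M.clipInventory d t : Past K t → ℝ) :=
  .of_mem_Icc ((M.measurable_inventory t).comp (measurable_clipPast d)) (M.clipInventory_mem d t)

theorem boundedMeasurable_clipRevenue (M : Model Θ K T) {d : ℝ} (hd : 0 ≤ d) (t : ℕ) :
    BoundedMeasurable (M.clipRevenue d t : Past K t → ℝ) :=
  .of_mem_Icc ((M.measurable_revenue t).comp (measurable_clipPast d)) (M.clipRevenue_mem hd t)

theorem boundedMeasurable_offerPrice (M : Model Θ K T) : BoundedMeasurable M.offerPrice :=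
  .of_mem_Icc M.measurable_offerPrice M.offerPrice_mem

theorem integral_revenue_eq {M : Model Θ K T} {d : ℝ} (hd : 0 ≤ d) (hM : M.DemandBounded d)
    (π : SeasonPolicy Θ K T) (p : Θ × Θ) :
    ∫ h, M.revenue T h ∂(M.seasonKernel π T le_rfl p) =
      ∫ h, M.clipRevenue d T h ∂(M.seasonKernel π T le_rfl p) := by
  refine integral_congr_ae ?_
  filter_upwards [ae_clipPast_eq hd hM π T le_rfl p] with h hh
  rw [clipRevenue, hh]

theorem integral_offer_eq_sum {μ : Measure (Offer K)} [IsFiniteMeasure μ] (G : Offer K → ℝ) :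
    ∫ o, G o ∂μ = μ.real {none} * G none + ∑ k, μ.real {some k} * G (some k) := by
  rw [integral_fintype (Integrable.of_finite)]
  simp [Fintype.sum_option]

theorem sum_real_some_le {μ : Measure (Offer K)} [IsProbabilityMeasure μ] :
    ∑ k, μ.real {some k} ≤ 1 := by
  have h := integral_offer_eq_sum (μ := μ) fun _ => 1
  simp only [integral_const, probReal_univ, smul_eq_mul, mul_one] at h
  have : 0 ≤ μ.real {none} := measureReal_nonneg
  linarith

theorem exists_value_of_remaining (M : Model Θ K T) {d : ℝ} (hd : 0 ≤ d) (j : ℕ) :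
    ∀ t (ht : t + j = T), ∃ V : Θ × ℝ → ℝ, BoundedMeasurable V ∧
      ∃ a : Fin T → Θ × ℝ → Offer K, (∀ i, Measurable (a i)) ∧
        (∀ (π : SeasonPolicy Θ K T) (θ : Θ),
          ∫ h, M.clipRevenue d T h ∂(M.seasonKernel π T le_rfl (θ, θ)) ≤
            ∫ h, M.clipRevenue d t h + V (θ, M.clipInventory d t h)
              ∂(M.seasonKernel π t (ht ▸ Nat.le_add_right t j) (θ, θ))) ∧
        ∀ π : SeasonPolicy Θ K T,
          (∀ (i : Fin T) (θ : Θ) (h : Past K i), t ≤ i →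
            π.offer i (θ, h) = Measure.dirac (a i (θ, M.clipInventory d i h))) →
          ∀ θ, ∫ h, M.clipRevenue d T h ∂(M.seasonKernel π T le_rfl (θ, θ)) =
            ∫ h, M.clipRevenue d t h + V (θ, M.clipInventory d t h)
              ∂(M.seasonKernel π t (ht ▸ Nat.le_add_right t j) (θ, θ)) := by
  induction j with
  | zero =>
    intro t ht
    obtain rfl : t = T := ht
    exact ⟨fun _ => 0, .const 0, fun _ _ => none, fun _ => measurable_const, by simp, by simp⟩
  | succ j ih =>
    intro t ht
    obtain ⟨V, hV, a, ha, hle, heq⟩ := ih (t + 1) (by omega)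
    have htT : t < T := by omega
    have hcl := measurable_clip d
    set Q : Offer K → Θ × ℝ → ℝ := fun o q => ∫ y, M.offerPrice o * min (clip d y) (max q.2 0) +
      V (q.1, max (q.2 - clip d y) 0) ∂(M.offerDemand ⟨t, htT⟩ (q.1, o)) with hQdef
    have hQ : ∀ o, BoundedMeasurable (Q o) := by
      intro o
      have h1 : BoundedMeasurable fun z : (Θ × ℝ) × ℝ =>
          M.offerPrice o * min (clip d z.2) (max z.1.2 0) + V (z.1.1, max (z.1.2 - clip d z.2) 0) := by
        refine (BoundedMeasurable.const_mul _ ?_).add (hV.comp (by fun_prop))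
        refine .of_mem_Icc (a := 0) (b := d) (by fun_prop) fun z => ⟨?_, ?_⟩
        · exact le_min (clip_nonneg _ _) (le_max_right _ _)
        · exact (min_le_left _ _).trans (clip_le hd _)
      exact h1.integral_kernel ((M.offerDemand ⟨t, htT⟩).comap (fun q : Θ × ℝ => (q.1, o))
        (by fun_prop))
    obtain ⟨b, hb, hW, hbmax⟩ := exists_boundedMeasurable_argmax Q hQ
    have key : ∀ (π : SeasonPolicy Θ K T) (θ : Θ),
        ∫ h, M.clipRevenue d (t + 1) h + V (θ, M.clipInventory d (t + 1) h)
          ∂(M.seasonKernel π (t + 1) htT (θ, θ)) =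
        ∫ h, ∫ o, (M.clipRevenue d t h + Q o (θ, M.clipInventory d t h))
          ∂(π.offer ⟨t, htT⟩ (θ, h)) ∂(M.seasonKernel π t htT.le (θ, θ)) := by
      intro π θ
      rw [M.integral_seasonKernel_succ π htT (θ, θ)
        ((M.boundedMeasurable_clipRevenue hd (t + 1)).add
          (hV.comp (measurable_const.prodMk (M.boundedMeasurable_clipInventory d (t + 1)).meas)))]
      refine integral_congr_ae (.of_forall fun h => integral_congr_ae (.of_forall fun o => ?_))
      simp only [clipRevenue_append, clipInventory_append, hQdef, add_assoc]
      have hI := (M.clipInventory_mem d t h).1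
      rw [max_eq_left hI, integral_add (integrable_const _)]
      · simp
      · refine BoundedMeasurable.integrable ?_ _
        refine (BoundedMeasurable.const_mul _ ?_).add (hV.comp (by fun_prop))
        refine .of_mem_Icc (a := 0) (b := d) (by fun_prop) fun z => ⟨?_, ?_⟩
        · exact le_min (clip_nonneg _ _) hI
        · exact (min_le_left _ _).trans (clip_le hd _)
    have hrQ : ∀ (π : SeasonPolicy Θ K T) (θ : Θ), BoundedMeasurable fun h : Past K t =>
        ∫ o, (M.clipRevenue d t h + Q o (θ, M.clipInventory d t h)) ∂(π.offer ⟨t, htT⟩ (θ, h)) := by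
      intro π θ
      have h1 : BoundedMeasurable fun z : Past K t × Offer K =>
          M.clipRevenue d t z.1 + Q z.2 (θ, M.clipInventory d t z.1) := by
        refine ((M.boundedMeasurable_clipRevenue hd t).comp measurable_fst).add ⟨?_, ?_⟩
        · exact measurable_from_prod_countable_left fun o => (hQ o).meas.comp
            (measurable_const.prodMk (M.boundedMeasurable_clipInventory d t).meas)
        · choose C hC using fun o => (hQ o).bdd
          refine ⟨∑ o, |C o|, fun x => ((hC x.2 _).trans (le_abs_self _)).trans ?_⟩
          exact Finset.single_le_sum (f := fun i => |C i|) (fun i _ => abs_nonneg _)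
            (Finset.mem_univ _)
      have hk : IsMarkovKernel ((π.offer ⟨t, htT⟩).comap (fun h : Past K t => (θ, h))
          measurable_prodMk_left) := ⟨fun h => (π.offer_markov ⟨t, htT⟩).isProbabilityMeasure (θ, h)⟩
      exact h1.integral_kernel ((π.offer ⟨t, htT⟩).comap (fun h : Past K t => (θ, h))
          measurable_prodMk_left)
    refine ⟨fun q => Q (b q) q, hW, fun i => if i = ⟨t, htT⟩ then b else a i,
      fun i => by dsimp only; split_ifs; exacts [hb, ha i], fun π θ => ?_, fun π hπ θ => ?_⟩
    · refine (hle π θ).trans ?_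
      rw [key]
      refine integral_mono ((hrQ π θ).integrable _)
        (((M.boundedMeasurable_clipRevenue hd t).add (hW.comp (measurable_const.prodMk
          (M.boundedMeasurable_clipInventory d t).meas))).integrable _) fun h => ?_
      have : IsProbabilityMeasure (π.offer ⟨t, htT⟩ (θ, h)) :=
        (π.offer_markov ⟨t, htT⟩).isProbabilityMeasure (θ, h)
      calc _ ≤ ∫ o, (M.clipRevenue d t h + Q (b (θ, M.clipInventory d t h))
            (θ, M.clipInventory d t h)) ∂(π.offer ⟨t, htT⟩ (θ, h)) :=
            integral_mono Integrable.of_finite (integrable_const _) fun o =>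
              add_le_add_right (hbmax o _) _
        _ = _ := by simp
    · rw [heq π (fun i θ h hi => ?_) θ, key]
      · refine integral_congr_ae (.of_forall fun h => ?_)
        have := hπ ⟨t, htT⟩ θ h le_rfl
        dsimp only at this ⊢
        rw [this, integral_dirac]
        simp
      · have hne : i ≠ ⟨t, htT⟩ := by
          rintro rfl
          simp at hi
        have := hπ i θ h (by omega)
        dsimp only at this
        rwa [if_neg hne] at this

/-- The policy whose offers are a function of the parameter, the period and the inventory. -/
theorem exists_inventory_policy (M : Model Θ K T) (d : ℝ) (a : Fin T → Θ × ℝ → Offer K)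
    (ha : ∀ i, Measurable (a i)) : ∃ π : SeasonPolicy Θ K T, ∀ (i : Fin T) (θ : Θ) (h : Past K i),
      π.offer i (θ, h) = Measure.dirac (a i (θ, M.clipInventory d i h)) := by
  have hm : ∀ i : Fin T, Measurable fun q : Θ × Past K i => a i (q.1, M.clipInventory d i q.2) :=
    fun i => (ha i).comp (measurable_fst.prodMk
      ((M.boundedMeasurable_clipInventory d i).meas.comp measurable_snd))
  refine ⟨⟨fun i => Kernel.deterministic _ (hm i), fun i => inferInstance⟩, fun i θ h => ?_⟩
  simp only [Kernel.deterministic_apply]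

/-- Some policy attains the optimal expected revenue, for every parameter value. -/
theorem exists_optimal_policy (M : Model Θ K T) {d : ℝ} (hd : 0 ≤ d) :
    ∃ π₀ : SeasonPolicy Θ K T, ∀ (π : SeasonPolicy Θ K T) (θ : Θ),
      ∫ h, M.clipRevenue d T h ∂(M.seasonKernel π T le_rfl (θ, θ)) ≤
        ∫ h, M.clipRevenue d T h ∂(M.seasonKernel π₀ T le_rfl (θ, θ)) := by
  obtain ⟨V, -, a, ha, hle, heq⟩ := M.exists_value_of_remaining hd T 0 (zero_add T)
  obtain ⟨π₀, h₀⟩ := M.exists_inventory_policy d a ha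
  refine ⟨π₀, fun π θ => ?_⟩
  rw [heq π₀ (fun i θ h _ => h₀ i θ h) θ]
  refine (hle π θ).trans (le_of_eq ?_)
  rw [integral_seasonKernel_zero, integral_seasonKernel_zero]

theorem exists_optRevenue_eq (M : Model Θ K T) {d : ℝ} (hd : 0 ≤ d) (hM : M.DemandBounded d) :
    ∃ π₀ : SeasonPolicy Θ K T, ∀ θ, M.optRevenue θ =
      ∫ h, M.clipRevenue d T h ∂(M.seasonKernel π₀ T le_rfl (θ, θ)) := by
  obtain ⟨π₀, h⟩ := M.exists_optimal_policy hd
  refine ⟨π₀, fun θ => ?_⟩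
  simp only [optRevenue, integral_revenue_eq hd hM]
  have : Nonempty (SeasonPolicy Θ K T) := ⟨π₀⟩
  exact le_antisymm (ciSup_le fun π => h π θ)
    (le_ciSup (f := fun π : SeasonPolicy Θ K T =>
      ∫ h, M.clipRevenue d T h ∂(M.seasonKernel π T le_rfl (θ, θ)))
      ⟨_, Set.forall_mem_range.2 fun π => h π θ⟩ π₀)

theorem meanDemand_eq_clip {M : Model Θ K T} {d : ℝ} (hM : M.DemandBounded d) (θ : Θ) (t : Fin T)
    (k : Fin K) : M.meanDemand θ t k = ∫ y, clip d y ∂(M.demand t k θ) := by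
  refine integral_congr_ae ?_
  filter_upwards [hM t k θ] with y hy
  rw [clip_of_mem hy]

theorem meanDemand_mem {M : Model Θ K T} {d : ℝ} (hd : 0 ≤ d) (hM : M.DemandBounded d) (θ : Θ)
    (t : Fin T) (k : Fin K) : M.meanDemand θ t k ∈ Set.Icc 0 d := by
  rw [meanDemand_eq_clip hM]
  refine ⟨integral_nonneg fun y => clip_nonneg d y, ?_⟩
  calc _ ≤ ∫ _, d ∂(M.demand t k θ) :=
        integral_mono ((boundedMeasurable_clip hd).integrable _) (integrable_const _)
          fun y => clip_le hd y
    _ = d := by simp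

theorem boundedMeasurable_meanDemand {M : Model Θ K T} {d : ℝ} (hd : 0 ≤ d)
    (hM : M.DemandBounded d) (t : Fin T) (k : Fin K) :
    BoundedMeasurable fun θ => M.meanDemand θ t k := by
  simp only [meanDemand_eq_clip hM]
  exact ((boundedMeasurable_clip hd).comp measurable_snd).integral_kernel (M.demand t k)

/-- The expected sales of price number `k` in period `t`. -/
noncomputable def expSales (M : Model Θ K T) (d : ℝ) (π : SeasonPolicy Θ K T) (θ : Θ) (i : Fin T)
    (k : Fin K) : ℝ :=
  ∫ h, (π.offer i (θ, h)).real {some k} *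
    ∫ y, min (clip d y) (M.clipInventory d i h) ∂(M.demand i k θ)
    ∂(M.seasonKernel π i i.2.le (θ, θ))

theorem boundedMeasurable_offer_real (π : SeasonPolicy Θ K T) (θ : Θ) (i : Fin T) (o : Offer K) :
    BoundedMeasurable fun h : Past K i => (π.offer i (θ, h)).real {o} := by
  refine .of_mem_Icc (a := 0) (b := 1) ?_ fun h => ⟨measureReal_nonneg, measureReal_le_one⟩
  exact ((Kernel.measurable_coe (π.offer i) (measurableSet_singleton o)).comp
    measurable_prodMk_left).ennreal_toReal

theorem boundedMeasurable_min_clip {α : Type*} [MeasurableSpace α] {d : ℝ} (hd : 0 ≤ d)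
    {I φ : α → ℝ} (hI : Measurable I) (hφ : Measurable φ) (h0 : ∀ x, 0 ≤ I x) :
    BoundedMeasurable fun x => min (clip d (φ x)) (I x) :=
  .of_mem_Icc (((measurable_clip d).comp hφ).min hI) fun x =>
    ⟨le_min (clip_nonneg d _) (h0 x), (min_le_left _ _).trans (clip_le hd _)⟩

theorem boundedMeasurable_integral_min (M : Model Θ K T) {d : ℝ} (hd : 0 ≤ d) (θ : Θ) (i : Fin T)
    (k : Fin K) : BoundedMeasurable fun h : Past K i =>
      ∫ y, min (clip d y) (M.clipInventory d i h) ∂(M.demand i k θ) := by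
  have h1 : BoundedMeasurable fun z : Past K i × ℝ =>
      min (clip d z.2) (M.clipInventory d i z.1) :=
    boundedMeasurable_min_clip hd ((M.boundedMeasurable_clipInventory d i).meas.comp measurable_fst)
      measurable_snd fun z => (M.clipInventory_mem d i z.1).1
  exact h1.integral_kernel (Kernel.const _ (M.demand i k θ))

theorem integral_add_sales (M : Model Θ K T) {d : ℝ} (hd : 0 ≤ d) (π : SeasonPolicy Θ K T) (θ : Θ)
    {t : ℕ} (ht : t < T) {F : Past K t → ℝ} (hF : BoundedMeasurable F) (c : Offer K → ℝ) :
    ∫ h, ∫ o, ∫ y, (F h + c o * min (clip d y) (M.clipInventory d t h))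
        ∂(M.offerDemand ⟨t, ht⟩ (θ, o)) ∂(π.offer ⟨t, ht⟩ (θ, h)) ∂(M.seasonKernel π t ht.le (θ, θ)) =
      ∫ h, F h ∂(M.seasonKernel π t ht.le (θ, θ)) +
        ∑ k, c (some k) * M.expSales d π θ ⟨t, ht⟩ k := by
  have hk : ∀ k, BoundedMeasurable fun h : Past K t => (π.offer ⟨t, ht⟩ (θ, h)).real {some k} *
      ∫ y, min (clip d y) (M.clipInventory d t h) ∂(M.demand ⟨t, ht⟩ k θ) := fun k =>
    (boundedMeasurable_offer_real π θ ⟨t, ht⟩ (some k)).mul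
      (M.boundedMeasurable_integral_min hd θ ⟨t, ht⟩ k)
  have h1 : ∀ h : Past K t, ∫ o, ∫ y, (F h + c o * min (clip d y) (M.clipInventory d t h))
        ∂(M.offerDemand ⟨t, ht⟩ (θ, o)) ∂(π.offer ⟨t, ht⟩ (θ, h)) =
      F h + ∑ k, c (some k) * ((π.offer ⟨t, ht⟩ (θ, h)).real {some k} *
        ∫ y, min (clip d y) (M.clipInventory d t h) ∂(M.demand ⟨t, ht⟩ k θ)) := by
    intro h
    have : IsProbabilityMeasure (π.offer ⟨t, ht⟩ (θ, h)) :=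
      (π.offer_markov ⟨t, ht⟩).isProbabilityMeasure (θ, h)
    have hI := (M.clipInventory_mem d t h).1
    have hin : ∀ o, ∫ y, (F h + c o * min (clip d y) (M.clipInventory d t h))
        ∂(M.offerDemand ⟨t, ht⟩ (θ, o)) = F h + c o * ∫ y, min (clip d y) (M.clipInventory d t h)
        ∂(M.offerDemand ⟨t, ht⟩ (θ, o)) := by
      intro o
      rw [integral_add (integrable_const _), integral_const_mul]
      · simp
      · exact ((boundedMeasurable_min_clip hd measurable_const measurable_id
          fun _ => hI).integrable _).const_mul _
    simp only [hin]
    rw [integral_add (integrable_const _) Integrable.of_finite, integral_offer_eq_sum (fun o => c o * _)]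
    simp only [offerDemand_none, offerDemand_some, integral_const, probReal_univ, one_smul,
      integral_dirac, clip_of_mem (Set.left_mem_Icc.2 hd), min_eq_left hI, mul_zero, zero_add]
    congr 1
    exact Finset.sum_congr rfl fun k _ => by ring
  simp only [h1]
  rw [integral_add (hF.integrable _)
    ((BoundedMeasurable.sum _ fun k _ => (hk k).const_mul _).integrable _),
    integral_finsetSum _ fun k _ => ((hk k).const_mul _).integrable _]
  simp only [integral_const_mul]
  rfl

theorem integral_clipRevenue_eq_sum (M : Model Θ K T) {d : ℝ} (hd : 0 ≤ d) (π : SeasonPolicy Θ K T)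
    (θ : Θ) (t : ℕ) (ht : t ≤ T) :
    ∫ h, M.clipRevenue d t h ∂(M.seasonKernel π t ht (θ, θ)) =
      ∑ i : Fin t, ∑ k, M.price k * M.expSales d π θ (Fin.castLE ht i) k := by
  induction t with
  | zero => rw [integral_seasonKernel_zero]; simp [clipRevenue, revenue]
  | succ t ih =>
    rw [M.integral_seasonKernel_succ π ht _ (M.boundedMeasurable_clipRevenue hd _)]
    simp only [clipRevenue_append]
    rw [M.integral_add_sales hd π θ ht (M.boundedMeasurable_clipRevenue hd t), ih,
      Fin.sum_univ_castSucc]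
    rfl

theorem integral_clipInventory_eq_sub (M : Model Θ K T) {d : ℝ} (hd : 0 ≤ d)
    (π : SeasonPolicy Θ K T) (θ : Θ) (t : ℕ) (ht : t ≤ T) :
    ∫ h, M.clipInventory d t h ∂(M.seasonKernel π t ht (θ, θ)) =
      M.n₀ - ∑ i : Fin t, ∑ k, M.expSales d π θ (Fin.castLE ht i) k := by
  induction t with
  | zero => rw [integral_seasonKernel_zero]; simp [clipInventory, inventory]
  | succ t ih =>
    rw [M.integral_seasonKernel_succ π ht _ (M.boundedMeasurable_clipInventory d _)]
    have h1 : ∀ n y : ℝ, max (n - y) 0 = n + (-1) * min y n := by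
      intro n y
      rcases le_total y n with h | h
      · rw [max_eq_left (by linarith), min_eq_left h]; ring
      · rw [max_eq_right (by linarith), min_eq_right h]; ring
    simp only [clipInventory_append, h1]
    rw [M.integral_add_sales hd π θ ht (M.boundedMeasurable_clipInventory d t) (fun _ => -1), ih,
      Fin.sum_univ_castSucc]
    simp only [← Finset.mul_sum]
    have : Fin.castLE ht (Fin.last t) = ⟨t, ht⟩ := rfl
    rw [this]
    simp only [Fin.castLE_castSucc]
    ring

theorem exists_expSales_le {M : Model Θ K T} {d : ℝ} (hd : 0 ≤ d) (hM : M.DemandBounded d)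
    (π : SeasonPolicy Θ K T) (θ : Θ) (i : Fin T) : ∃ w : Fin K → ℝ, (∀ k, 0 ≤ w k) ∧
      ∑ k, w k ≤ 1 ∧ ∀ k, 0 ≤ M.expSales d π θ i k ∧
        M.expSales d π θ i k ≤ w k * M.meanDemand θ i k := by
  refine ⟨fun k => ∫ h, (π.offer i (θ, h)).real {some k} ∂(M.seasonKernel π i i.2.le (θ, θ)),
    fun k => integral_nonneg fun h => measureReal_nonneg, ?_, fun k => ⟨?_, ?_⟩⟩
  · rw [← integral_finsetSum _ fun k _ =>
      (boundedMeasurable_offer_real π θ i (some k)).integrable _]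
    calc _ ≤ ∫ _, (1 : ℝ) ∂(M.seasonKernel π i i.2.le (θ, θ)) :=
          integral_mono (integrable_finsetSum _ fun k _ =>
            (boundedMeasurable_offer_real π θ i (some k)).integrable _) (integrable_const _)
            fun h => sum_real_some_le
      _ = 1 := by simp
  · exact integral_nonneg fun h => mul_nonneg measureReal_nonneg (integral_nonneg fun y =>
      le_min (clip_nonneg _ _) (M.clipInventory_mem d i h).1)
  · rw [← integral_mul_const]
    refine integral_mono (((boundedMeasurable_offer_real π θ i (some k)).mul
      (M.boundedMeasurable_integral_min hd θ i k)).integrable _)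
      (((boundedMeasurable_offer_real π θ i (some k)).integrable _).mul_const _) fun h => ?_
    refine mul_le_mul_of_nonneg_left ?_ measureReal_nonneg
    rw [meanDemand_eq_clip hM]
    exact integral_mono ((boundedMeasurable_min_clip hd measurable_const measurable_id
      fun _ => (M.clipInventory_mem d i h).1).integrable _)
      ((boundedMeasurable_clip hd).integrable _) fun y => min_le_left _ _

/-- The linear program bounds the expected revenue of every policy. -/
theorem integral_clipRevenue_le_lpValue {M : Model Θ K T} {d : ℝ} (hd : 0 ≤ d)
    (hM : M.DemandBounded d) (π : SeasonPolicy Θ K T) (θ : Θ) {x : Fin T → Fin K → ℝ}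
    (hx : M.LPOptimal θ M.n₀ x) :
    ∫ h, M.clipRevenue d T h ∂(M.seasonKernel π T le_rfl (θ, θ)) ≤ M.lpValue θ x := by
  choose w hw0 hw1 hw using exists_expSales_le hd hM π θ
  have hl := fun i k => (meanDemand_mem hd hM θ i k).1
  set y : Fin T → Fin K → ℝ := fun i k =>
    if M.meanDemand θ i k = 0 then 0 else M.expSales d π θ i k / M.meanDemand θ i k with hy
  have hyl : ∀ i k, y i k * M.meanDemand θ i k = M.expSales d π θ i k := by
    intro i k
    simp only [hy]
    split_ifs with h0
    · have := hw i k
      rw [h0, mul_zero] at this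
      linarith [this.1, this.2]
    · field_simp
  have hy0 : ∀ i k, 0 ≤ y i k := by
    intro i k
    simp only [hy]
    split_ifs
    · exact le_rfl
    · exact div_nonneg (hw i k).1 (hl i k)
  have hyw : ∀ i k, y i k ≤ w i k := by
    intro i k
    simp only [hy]
    split_ifs with h0
    · exact hw0 i k
    · exact div_le_of_le_mul₀ (hl i k) (hw0 i k) (hw i k).2
  have hfeas : M.LPFeasible θ M.n₀ y := by
    refine ⟨fun i k => ⟨hy0 i k, (hyw i k).trans ?_⟩, ?_, fun i =>
      (Finset.sum_le_sum fun k _ => hyw i k).trans (hw1 i)⟩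
    · exact (Finset.single_le_sum (fun k _ => hw0 i k) (Finset.mem_univ k)).trans (hw1 i)
    · simp only [hyl]
      have h1 := M.integral_clipInventory_eq_sub hd π θ T le_rfl
      have h2 : 0 ≤ ∫ h, M.clipInventory d T h ∂(M.seasonKernel π T le_rfl (θ, θ)) :=
        integral_nonneg fun h => (M.clipInventory_mem d T h).1
      simp only [Fin.castLE_rfl, id] at h1
      linarith
  refine le_trans (le_of_eq ?_) (hx.2 y hfeas)
  rw [M.integral_clipRevenue_eq_sum hd, lpValue]
  simp only [hyl, Fin.castLE_rfl, id, mul_comm]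

end Model

end EpisodicRM

namespace EpisodicRM

variable {Θ : Type*} [MeasurableSpace Θ] {K T : ℕ}

theorem sq_integral_abs_le {α : Type*} [MeasurableSpace α] {μ : Measure α}
    [IsProbabilityMeasure μ] {Z : α → ℝ} (hZ : BoundedMeasurable Z) :
    (∫ a, |Z a| ∂μ) ^ 2 ≤ ∫ a, Z a * Z a ∂μ := by
  set c := ∫ a, |Z a| ∂μ with hc
  have h0 : 0 ≤ ∫ a, (Z a * Z a + (-(2 * c) * |Z a| + c * c)) ∂μ :=
    integral_nonneg fun a => by
      have := abs_mul_abs_self (Z a)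
      have h2 := mul_self_nonneg (|Z a| - c)
      simp only [Pi.zero_apply]
      nlinarith
  rw [integral_add ((hZ.mul hZ).integrable _)
    (((hZ.abs.const_mul _).add (.const _)).integrable _),
    integral_add ((hZ.abs.const_mul _).integrable _) (integrable_const _), integral_const_mul,
    ← hc] at h0
  simp only [integral_const, probReal_univ, one_smul] at h0
  nlinarith

namespace LPSolver

variable {M : Model Θ K T} (R : LPSolver M)

theorem x_nonneg (θ : Θ) (i : Fin T) (k : Fin K) : 0 ≤ R.x θ i k := ((R.optimal θ).1.1 i k).1

theorem x_le_one (θ : Θ) (i : Fin T) (k : Fin K) : R.x θ i k ≤ 1 := ((R.optimal θ).1.1 i k).2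

theorem sum_x_le_one (θ : Θ) (i : Fin T) : ∑ k, R.x θ i k ≤ 1 := (R.optimal θ).1.2.2 i

theorem boundedMeasurable_x (i : Fin T) (k : Fin K) : BoundedMeasurable fun θ => R.x θ i k :=
  .of_mem_Icc (R.measurable_x i k) fun θ => ⟨R.x_nonneg θ i k, R.x_le_one θ i k⟩

instance isProbabilityMeasure_offerLaw_x (θ : Θ) (i : Fin T) :
    IsProbabilityMeasure (offerLaw (R.x θ i)) :=
  isProbabilityMeasure_offerLaw (R.x_nonneg θ i) (R.sum_x_le_one θ i)

/-- The distribution of the observation of period `i`, given the true parameter `p.1` and the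
sampled parameter `p.2`. -/
noncomputable def periodLaw (p : Θ × Θ) (i : Fin T) : Measure (Obs K) :=
  offerLaw (R.x p.2 i) ⊗ₘ (M.offerDemand i).comap (fun o => (p.1, o)) measurable_prodMk_left

instance isProbabilityMeasure_periodLaw (p : Θ × Θ) (i : Fin T) :
    IsProbabilityMeasure (R.periodLaw p i) := by
  unfold periodLaw; infer_instance

theorem integral_offerLaw (θ : Θ) (i : Fin T) (G : Offer K → ℝ) :
    ∫ o, G o ∂(offerLaw (R.x θ i)) =
      (1 - ∑ k, R.x θ i k) * G none + ∑ k, R.x θ i k * G (some k) := by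
  have hI : ∀ (c : ℝ) (o : Offer K), Integrable G (ENNReal.ofReal c • Measure.dirac o) :=
    fun c o => Integrable.of_finite.smul_measure ENNReal.ofReal_ne_top
  rw [offerLaw, integral_add_measure (integrable_finsetSum_measure.2 fun k _ => hI _ _) (hI _ _),
    integral_finsetSum_measure fun k _ => hI _ _, integral_smul_measure,
    integral_dirac, ENNReal.toReal_ofReal (by linarith [R.sum_x_le_one θ i]), add_comm]
  congr 1
  refine Finset.sum_congr rfl fun k _ => ?_
  rw [integral_smul_measure, integral_dirac, ENNReal.toReal_ofReal (R.x_nonneg θ i k), smul_eq_mul]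

theorem integral_periodLaw (p : Θ × Θ) (i : Fin T) {g : Obs K → ℝ} (hg : BoundedMeasurable g) :
    ∫ o, g o ∂(R.periodLaw p i) = (1 - ∑ k, R.x p.2 i k) * g (none, 0) +
      ∑ k, R.x p.2 i k * ∫ y, g (some k, y) ∂(M.demand i k p.1) := by
  rw [periodLaw, Measure.integral_compProd (hg.integrable _), integral_offerLaw]
  simp only [Kernel.comap_apply, Model.offerDemand_none, Model.offerDemand_some, integral_dirac]

theorem integral_seasonKernel_policy_succ {t : ℕ} (ht : t + 1 ≤ T) (p : Θ × Θ)
    {g : Past K (t + 1) → ℝ} (hg : BoundedMeasurable g) :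
    ∫ h, g h ∂(M.seasonKernel R.policy (t + 1) ht p) =
      ∫ h, ∫ o, g (append (h, o)) ∂(R.periodLaw p ⟨t, ht⟩)
        ∂(M.seasonKernel R.policy t (Nat.le_of_succ_le ht) p) := by
  rw [M.integral_seasonKernel_succ R.policy ht p hg]
  refine integral_congr_ae (.of_forall fun h => ?_)
  have hgh : BoundedMeasurable fun o : Obs K => g (append (h, o)) :=
    hg.comp (measurable_append.comp measurable_prodMk_left)
  dsimp only
  rw [periodLaw, Measure.integral_compProd (hgh.integrable _)]
  rfl

theorem integral_seasonKernel_period {t : ℕ} (ht : t ≤ T) (p : Θ × Θ) (i : Fin t)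
    {g : Obs K → ℝ} (hg : BoundedMeasurable g) :
    ∫ h, g (h i) ∂(M.seasonKernel R.policy t ht p) =
      ∫ o, g o ∂(R.periodLaw p (Fin.castLE ht i)) := by
  induction t with
  | zero => exact i.elim0
  | succ t ih =>
    rw [R.integral_seasonKernel_policy_succ ht p (hg.comp (measurable_pi_apply i))]
    refine Fin.lastCases ?_ (fun j => ?_) i
    · simp only [append_last, integral_const, probReal_univ, one_smul]
      rfl
    · simp only [append_castSucc, integral_const, probReal_univ, one_smul]
      exact ih _ j

/-- The mean demand of period `i`, given the true parameter and the sampled parameter. -/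
noncomputable def meanPeriodDemand (p : Θ × Θ) (i : Fin T) : ℝ :=
  ∑ k, R.x p.2 i k * M.meanDemand p.1 i k

variable {d : ℝ}

theorem boundedMeasurable_clip_snd (hd : 0 ≤ d) :
    BoundedMeasurable fun o : Obs K => clip d o.2 :=
  (boundedMeasurable_clip hd).comp measurable_snd

theorem integral_clip_periodLaw (hd : 0 ≤ d) (hM : M.DemandBounded d) (p : Θ × Θ) (i : Fin T) :
    ∫ o, clip d o.2 ∂(R.periodLaw p i) = R.meanPeriodDemand p i := by
  rw [R.integral_periodLaw p i (boundedMeasurable_clip_snd hd),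
    clip_of_mem (Set.left_mem_Icc.2 hd), mul_zero, zero_add]
  simp only [meanPeriodDemand, Model.meanDemand_eq_clip hM]

theorem meanPeriodDemand_mem (hd : 0 ≤ d) (hM : M.DemandBounded d) (p : Θ × Θ) (i : Fin T) :
    R.meanPeriodDemand p i ∈ Set.Icc 0 d := by
  rw [← R.integral_clip_periodLaw hd hM]
  refine ⟨integral_nonneg fun o => clip_nonneg d o.2, ?_⟩
  calc _ ≤ ∫ _, d ∂(R.periodLaw p i) :=
        integral_mono ((boundedMeasurable_clip_snd hd).integrable _) (integrable_const _)
          fun o => clip_le hd o.2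
    _ = d := by simp

/-- The deviation of the total demand of the first `t` periods from its mean. -/
noncomputable def demandDeviation (d : ℝ) (p : Θ × Θ) {t : ℕ} (ht : t ≤ T) (h : Past K t) : ℝ :=
  ∑ i, (clip d (h i).2 - R.meanPeriodDemand p (Fin.castLE ht i))

theorem boundedMeasurable_demandDeviation (hd : 0 ≤ d) (p : Θ × Θ) {t : ℕ} (ht : t ≤ T) :
    BoundedMeasurable (R.demandDeviation d p ht) :=
  .sum _ fun i _ => ((boundedMeasurable_clip_snd hd).comp (measurable_pi_apply i)).sub (.const _)

theorem integral_demandDeviation_sq_le (hd : 0 ≤ d) (hM : M.DemandBounded d) (p : Θ × Θ) {t : ℕ}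
    (ht : t ≤ T) :
    ∫ h, R.demandDeviation d p ht h * R.demandDeviation d p ht h
      ∂(M.seasonKernel R.policy t ht p) ≤ t * d ^ 2 := by
  induction t with
  | zero => simp [demandDeviation]
  | succ t ih =>
    have hZ := R.boundedMeasurable_demandDeviation hd p ht
    have hZ' := R.boundedMeasurable_demandDeviation hd p (Nat.le_of_succ_le ht)
    rw [R.integral_seasonKernel_policy_succ ht p (hZ.mul hZ)]
    set m := R.meanPeriodDemand p ⟨t, ht⟩ with hm
    have hmm := R.meanPeriodDemand_mem hd hM p ⟨t, ht⟩
    have hξ : BoundedMeasurable fun o : Obs K => clip d o.2 - m :=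
      (boundedMeasurable_clip_snd hd).sub (.const _)
    have happ : ∀ (h : Past K t) (o : Obs K), R.demandDeviation d p ht (append (h, o)) =
        R.demandDeviation d p (Nat.le_of_succ_le ht) h + (clip d o.2 - m) := by
      intro h o
      simp only [demandDeviation, Fin.sum_univ_castSucc, append_castSucc, append_last]
      rfl
    have hinner : ∀ h : Past K t, ∫ o, R.demandDeviation d p ht (append (h, o)) *
        R.demandDeviation d p ht (append (h, o)) ∂(R.periodLaw p ⟨t, ht⟩) ≤
        R.demandDeviation d p (Nat.le_of_succ_le ht) h *
          R.demandDeviation d p (Nat.le_of_succ_le ht) h + d ^ 2 := by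
      intro h
      set z := R.demandDeviation d p (Nat.le_of_succ_le ht) h
      have h0 : ∫ o, (clip d o.2 - m) ∂(R.periodLaw p ⟨t, ht⟩) = 0 := by
        rw [integral_sub ((boundedMeasurable_clip_snd hd).integrable _) (integrable_const _),
          R.integral_clip_periodLaw hd hM]
        simp [hm]
      calc _ = ∫ o, (z * z + (2 * z) * (clip d o.2 - m) + (clip d o.2 - m) * (clip d o.2 - m))
            ∂(R.periodLaw p ⟨t, ht⟩) :=
            integral_congr_ae (.of_forall fun o => by simp only [happ]; ring)
        _ = z * z + ∫ o, (clip d o.2 - m) * (clip d o.2 - m) ∂(R.periodLaw p ⟨t, ht⟩) := by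
            rw [integral_add (((BoundedMeasurable.const (z * z)).add (hξ.const_mul _)).integrable _)
              ((hξ.mul hξ).integrable _), integral_add (integrable_const _)
              ((hξ.const_mul _).integrable _), integral_const_mul (2 * z), h0]
            simp
        _ ≤ z * z + ∫ _, d ^ 2 ∂(R.periodLaw p ⟨t, ht⟩) := by
            refine add_le_add_right (integral_mono ((hξ.mul hξ).integrable _)
              (integrable_const _) fun o => ?_) _
            have h1 := clip_nonneg d o.2
            have h2 := clip_le hd o.2
            have h3 : |clip d o.2 - m| ≤ d := abs_le.2 ⟨by linarith [hmm.2], by linarith [hmm.1]⟩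
            dsimp only
            rw [← sq]
            exact sq_le_sq' (by linarith [(abs_le.1 h3).1]) (abs_le.1 h3).2
        _ = _ := by simp
    calc _ ≤ ∫ h, (R.demandDeviation d p (Nat.le_of_succ_le ht) h *
          R.demandDeviation d p (Nat.le_of_succ_le ht) h + d ^ 2)
          ∂(M.seasonKernel R.policy t (Nat.le_of_succ_le ht) p) := by
          refine integral_mono ?_ (((hZ'.mul hZ').add (.const _)).integrable _) hinner
          have hG : BoundedMeasurable fun z : Past K t × Obs K =>
            R.demandDeviation d p ht (append z) * R.demandDeviation d p ht (append z) :=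
            (hZ.mul hZ).comp measurable_append
          exact (hG.integral_kernel (Kernel.const _ (R.periodLaw p ⟨t, ht⟩))).integrable _
      _ ≤ _ := by
          rw [integral_add ((hZ'.mul hZ').integrable _) (integrable_const _)]
          simp only [integral_const, probReal_univ, one_smul]
          push_cast
          linarith [ih (Nat.le_of_succ_le ht)]

/-- The revenue of a season falls short of the value of all its demands by at most the largest
price times the demand in excess of the inventory. -/
theorem le_clipRevenue (M : Model Θ K T) (d : ℝ) (t : ℕ) (h : Past K t) :
    M.clipInventory d t h = max (M.n₀ - ∑ i, clip d (h i).2) 0 ∧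
      ∑ i, M.offerPrice (h i).1 * clip d (h i).2 -
        M.maxPrice * max (∑ i, clip d (h i).2 - M.n₀) 0 ≤ M.clipRevenue d t h := by
  induction t with
  | zero =>
    simp [Model.clipInventory, Model.clipRevenue, Model.inventory, Model.revenue, M.n₀_nonneg]
  | succ t ih =>
    obtain ⟨q, o, rfl⟩ := Model.exists_eq_append h
    obtain ⟨h1, h2⟩ := ih q
    rw [Model.clipInventory_append, Model.clipRevenue_append, h1]
    simp only [Fin.sum_univ_castSucc, append_castSucc, append_last]
    set C := ∑ i, clip d (q i).2
    set y := clip d o.2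
    have hy : 0 ≤ y := clip_nonneg d o.2
    have hp := M.offerPrice_mem o.1
    set P := M.offerPrice o.1
    constructor
    · rcases le_total (M.n₀ - C) 0 with hc | hc
      · rw [max_eq_right hc, max_eq_right (by linarith), max_eq_right (by linarith)]
      · rw [max_eq_left hc]; congr 1; ring
    · have key : y - (max (C + y - M.n₀) 0 - max (C - M.n₀) 0) ≤ min y (max (M.n₀ - C) 0) := by
        refine le_min ?_ ?_
        · have := max_le_max_right 0 (show C - M.n₀ ≤ C + y - M.n₀ by linarith)
          linarith
        · have e1 : C - M.n₀ = -(M.n₀ - C) := by ring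
          have h3 := le_max_left (C + y - M.n₀) 0
          have h4 := max_zero_sub_eq_self (M.n₀ - C)
          rw [e1, max_comm (-(M.n₀ - C)), max_comm (M.n₀ - C)]
          rw [max_comm, max_comm (-(M.n₀ - C))] at h4
          linarith
      have hE : 0 ≤ max (C + y - M.n₀) 0 - max (C - M.n₀) 0 :=
        sub_nonneg.2 (max_le_max_right 0 (by linarith))
      have h5 := mul_le_mul_of_nonneg_left key hp.1
      have h6 := mul_le_mul_of_nonneg_right hp.2 hE
      nlinarith

/-- The absolute deviation of the mean demands under the true parameter from those under the
sampled parameter, weighted by the probabilities of the offers. -/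
noncomputable def demandError (p : Θ × Θ) (i : Fin T) : ℝ :=
  ∑ k, R.x p.2 i k * |M.meanDemand p.2 i k - M.meanDemand p.1 i k|

theorem integral_excess_le (hd : 0 ≤ d) (hM : M.DemandBounded d) (p : Θ × Θ) :
    ∫ h, max (∑ i, clip d (h i).2 - M.n₀) 0 ∂(M.seasonKernel R.policy T le_rfl p) ≤
      d * √T + max (∑ i, R.meanPeriodDemand p i - M.n₀) 0 := by
  have hZ := R.boundedMeasurable_demandDeviation hd p (le_refl T)
  have hs : BoundedMeasurable fun h : Past K T => ∑ i, clip d (h i).2 - M.n₀ :=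
    (BoundedMeasurable.sum _ fun i _ =>
      (boundedMeasurable_clip_snd hd).comp (measurable_pi_apply i)).sub (.const _)
  have habs : ∫ h, |R.demandDeviation d p le_rfl h| ∂(M.seasonKernel R.policy T le_rfl p) ≤
      d * √T := by
    refine abs_le_of_sq_le_sq' ?_ (by positivity) |>.2
    refine (sq_integral_abs_le hZ).trans ((R.integral_demandDeviation_sq_le hd hM p le_rfl).trans ?_)
    rw [mul_pow, Real.sq_sqrt (Nat.cast_nonneg _), mul_comm]
  calc _ ≤ ∫ h, (|R.demandDeviation d p le_rfl h| +
        max (∑ i, R.meanPeriodDemand p i - M.n₀) 0) ∂(M.seasonKernel R.policy T le_rfl p) := by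
        refine integral_mono ((hs.max (.const 0)).integrable _)
          ((hZ.abs.add (.const _)).integrable _) fun h => ?_
        have : ∑ i, clip d (h i).2 - M.n₀ = R.demandDeviation d p le_rfl h +
            (∑ i, R.meanPeriodDemand p i - M.n₀) := by
          simp only [demandDeviation, Finset.sum_sub_distrib, Fin.castLE_rfl, id]
          ring
        dsimp only
        rw [this]
        exact max_le (add_le_add (le_abs_self _) (le_max_left _ _))
          (add_nonneg (abs_nonneg _) (le_max_right _ _))
    _ ≤ _ := by
        rw [integral_add (hZ.abs.integrable _) (integrable_const _)]
        simpa using habs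

/-- The regret of one season against the linear program of the sampled parameter. -/
theorem lpValue_sub_integral_clipRevenue_le (hd : 0 ≤ d) (hM : M.DemandBounded d) (p : Θ × Θ) :
    M.lpValue p.2 (R.x p.2) - ∫ h, M.clipRevenue d T h ∂(M.seasonKernel R.policy T le_rfl p) ≤
      M.maxPrice * (d * √T + ∑ i, R.demandError p i) := by
  have hg : BoundedMeasurable fun o : Obs K => M.offerPrice o.1 * clip d o.2 :=
    (M.boundedMeasurable_offerPrice.comp measurable_fst).mul (boundedMeasurable_clip_snd hd)
  have hgi : ∀ i : Fin T, BoundedMeasurable fun h : Past K T =>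
      M.offerPrice (h i).1 * clip d (h i).2 := fun i => hg.comp (measurable_pi_apply i)
  have hex : BoundedMeasurable fun h : Past K T => max (∑ i, clip d (h i).2 - M.n₀) 0 :=
    ((BoundedMeasurable.sum _ fun i _ =>
      (boundedMeasurable_clip_snd hd).comp (measurable_pi_apply i)).sub (.const _)).max (.const 0)
  have h1 : ∑ i, ∑ k, R.x p.2 i k * (M.price k * M.meanDemand p.1 i k) -
      M.maxPrice * ∫ h, max (∑ i, clip d (h i).2 - M.n₀) 0
        ∂(M.seasonKernel R.policy T le_rfl p) ≤
      ∫ h, M.clipRevenue d T h ∂(M.seasonKernel R.policy T le_rfl p) := by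
    have hgross : ∫ h, ∑ i, M.offerPrice (h i).1 * clip d (h i).2
        ∂(M.seasonKernel R.policy T le_rfl p) =
        ∑ i, ∑ k, R.x p.2 i k * (M.price k * M.meanDemand p.1 i k) := by
      rw [integral_finsetSum _ fun i _ => (hgi i).integrable _]
      refine Finset.sum_congr rfl fun i _ => ?_
      rw [R.integral_seasonKernel_period le_rfl p i hg, R.integral_periodLaw p _ hg]
      simp only [clip_of_mem (Set.left_mem_Icc.2 hd), mul_zero, zero_add, Model.offerPrice,
        integral_const_mul, Model.meanDemand_eq_clip hM, Fin.castLE_rfl, id]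
    rw [← hgross, ← integral_const_mul, ← integral_sub
      ((BoundedMeasurable.sum _ fun i _ => hgi i).integrable _) ((hex.const_mul _).integrable _)]
    exact integral_mono (((BoundedMeasurable.sum _ fun i _ => hgi i).sub
      (hex.const_mul _)).integrable _) ((M.boundedMeasurable_clipRevenue hd T).integrable _)
      fun h => (le_clipRevenue M d T h).2
  have h2 := mul_le_mul_of_nonneg_left (R.integral_excess_le hd hM p) M.maxPrice_nonneg
  have h3 : max (∑ i, R.meanPeriodDemand p i - M.n₀) 0 ≤
      ∑ i, ∑ k, R.x p.2 i k * max (M.meanDemand p.1 i k - M.meanDemand p.2 i k) 0 := by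
    refine max_le ?_ (Finset.sum_nonneg fun i _ => Finset.sum_nonneg fun k _ =>
      mul_nonneg (R.x_nonneg _ _ _) (le_max_right _ _))
    have hf := (R.optimal p.2).1.2.1
    calc _ ≤ ∑ i, R.meanPeriodDemand p i - ∑ i, ∑ k, R.x p.2 i k * M.meanDemand p.2 i k := by
          linarith
      _ = ∑ i, ∑ k, R.x p.2 i k * (M.meanDemand p.1 i k - M.meanDemand p.2 i k) := by
          simp only [meanPeriodDemand, ← Finset.sum_sub_distrib, mul_sub]
      _ ≤ _ := Finset.sum_le_sum fun i _ => Finset.sum_le_sum fun k _ =>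
          mul_le_mul_of_nonneg_left (le_max_left _ _) (R.x_nonneg _ _ _)
  have h4 := mul_le_mul_of_nonneg_left h3 M.maxPrice_nonneg
  have h5 : M.lpValue p.2 (R.x p.2) - ∑ i, ∑ k, R.x p.2 i k * (M.price k * M.meanDemand p.1 i k) +
      M.maxPrice * ∑ i, ∑ k, R.x p.2 i k * max (M.meanDemand p.1 i k - M.meanDemand p.2 i k) 0 ≤
      M.maxPrice * ∑ i, R.demandError p i := by
    simp only [Model.lpValue, demandError, Finset.mul_sum, ← Finset.sum_sub_distrib,
      ← Finset.sum_add_distrib]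
    refine Finset.sum_le_sum fun i _ => Finset.sum_le_sum fun k _ => ?_
    have hx := R.x_nonneg p.2 i k
    have hp := M.price_le_maxPrice k
    have hp0 := M.price_nonneg k
    set a := M.meanDemand p.2 i k
    set b := M.meanDemand p.1 i k
    have : M.price k * (a - b) + M.maxPrice * max (b - a) 0 ≤ M.maxPrice * |a - b| := by
      rcases le_total a b with hab | hab
      · rw [max_eq_left (by linarith), abs_of_nonpos (by linarith)]
        nlinarith
      · rw [max_eq_right (by linarith), abs_of_nonneg (by linarith)]
        nlinarith
    nlinarith [mul_le_mul_of_nonneg_left this hx]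
  nlinarith

end LPSolver

end EpisodicRM

namespace EpisodicRM

theorem BoundedMeasurable.comp_nat {α : Type*} [MeasurableSpace α] {Ψ : ℕ → ℝ → ℝ}
    (hΨ : ∀ n, Continuous (Ψ n)) {N : α → ℕ} (hN : Measurable N) {s : ℕ} (hs : ∀ x, N x ≤ s)
    {X : α → ℝ} (hX : BoundedMeasurable X) : BoundedMeasurable fun x => Ψ (N x) (X x) := by
  have h1 : BoundedMeasurable fun x =>
      ∑ n ∈ Finset.range (s + 1), if N x = n then Ψ n (X x) else 0 :=
    .sum _ fun n _ => .ite (hN (measurableSet_singleton n)) (hX.comp_continuous (hΨ n)) (.const 0)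
  convert h1 using 2 with x
  rw [Finset.sum_ite_eq, if_pos (Finset.mem_range.2 (Nat.lt_succ_of_le (hs x)))]

/-- The exponential weight of a centred sum `x` of `n` terms in an interval of length one. -/
noncomputable def expWeight (μ : ℝ) (n : ℕ) (x : ℝ) : ℝ := Real.exp (μ * x - μ ^ 2 * n / 8)

theorem expWeight_nonneg (μ : ℝ) (n : ℕ) (x : ℝ) : 0 ≤ expWeight μ n x := (Real.exp_pos _).le

theorem continuous_expWeight (μ : ℝ) (n : ℕ) : Continuous (expWeight μ n) := by
  unfold expWeight; fun_prop

variable {Θ : Type*} [MeasurableSpace Θ] {K T : ℕ}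

section Statistics

/-- The number of seasons in which price number `k` was offered in period `i`. -/
def pulls (i : Fin T) (k : Fin K) {s : ℕ} (h : History K T s) : ℕ :=
  ∑ j, if (h j i).1 = some k then 1 else 0

/-- The sum of the deviations of the demands of period `i` under price number `k` from their mean
under the parameter `θ`, in units of `d`. -/
noncomputable def pullDeviation (M : Model Θ K T) (d : ℝ) (i : Fin T) (k : Fin K) (θ : Θ) {s : ℕ}
    (h : History K T s) : ℝ :=
  ∑ j, if (h j i).1 = some k then (clip d (h j i).2 - M.meanDemand θ i k) / d else 0

theorem pulls_append (i : Fin T) (k : Fin K) {s : ℕ} (h : History K T s) (q : Past K T) :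
    pulls i k (append (h, q)) = pulls i k h + if (q i).1 = some k then 1 else 0 := by
  simp only [pulls, Fin.sum_univ_castSucc, append_castSucc, append_last]

theorem pullDeviation_append (M : Model Θ K T) (d : ℝ) (i : Fin T) (k : Fin K) (θ : Θ) {s : ℕ}
    (h : History K T s) (q : Past K T) :
    pullDeviation M d i k θ (append (h, q)) = pullDeviation M d i k θ h +
      if (q i).1 = some k then (clip d (q i).2 - M.meanDemand θ i k) / d else 0 := by
  simp [pullDeviation, Fin.sum_univ_castSucc]

theorem measurableSet_offer_eq (i : Fin T) (k : Fin K) {s : ℕ} (j : Fin s) :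
    MeasurableSet {h : History K T s | (h j i).1 = some k} :=
  ((measurable_pi_apply i).comp (measurable_pi_apply j)).fst (measurableSet_singleton (some k))

theorem measurable_pulls (i : Fin T) (k : Fin K) {s : ℕ} :
    Measurable (pulls i k : History K T s → ℕ) :=
  Finset.measurable_sum _ fun j _ =>
    Measurable.ite (measurableSet_offer_eq i k j) measurable_const measurable_const

theorem sum_pulls_le (i : Fin T) {s : ℕ} (h : History K T s) : ∑ k, pulls i k h ≤ s := by
  simp only [pulls]
  rw [Finset.sum_comm]
  calc _ ≤ ∑ _j : Fin s, 1 := Finset.sum_le_sum fun j _ => by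
        cases (h j i).1 <;> simp
    _ = s := by simp

theorem pulls_le (i : Fin T) (k : Fin K) {s : ℕ} (h : History K T s) : pulls i k h ≤ s :=
  (Finset.single_le_sum (f := fun k => pulls i k h) (fun _ _ => Nat.zero_le _)
    (Finset.mem_univ k)).trans (sum_pulls_le i h)

variable {M : Model Θ K T} {d : ℝ}

theorem boundedMeasurable_pullDeviation (hd : 0 ≤ d) (hM : M.DemandBounded d) (i : Fin T)
    (k : Fin K) {s : ℕ} :
    BoundedMeasurable fun z : Θ × History K T s => pullDeviation M d i k z.1 z.2 := by
  refine .sum _ fun j _ => .ite (measurable_snd (measurableSet_offer_eq i k j)) ?_ (.const 0)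
  simp only [div_eq_inv_mul]
  refine .const_mul _ (.sub ((boundedMeasurable_clip hd).comp (by fun_prop)) ?_)
  exact (Model.boundedMeasurable_meanDemand hd hM i k).comp measurable_fst

theorem boundedMeasurable_arm (hd : 0 ≤ d) (hM : M.DemandBounded d) (i : Fin T) (k : Fin K) {s : ℕ}
    {Ψ : ℕ → ℝ → ℝ} (hΨ : ∀ n, Continuous (Ψ n)) :
    BoundedMeasurable fun z : Θ × History K T s =>
      Ψ (pulls i k z.2) (pullDeviation M d i k z.1 z.2) :=
  .comp_nat hΨ ((measurable_pulls i k).comp measurable_snd) (fun z => pulls_le i k z.2)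
    (boundedMeasurable_pullDeviation hd hM i k)

theorem boundedMeasurable_arm_right (hd : 0 ≤ d) (hM : M.DemandBounded d) (i : Fin T) (k : Fin K)
    {s : ℕ} {Ψ : ℕ → ℝ → ℝ} (hΨ : ∀ n, Continuous (Ψ n)) (θ : Θ) :
    BoundedMeasurable fun h : History K T s => Ψ (pulls i k h) (pullDeviation M d i k θ h) :=
  (boundedMeasurable_arm hd hM i k hΨ).comp measurable_prodMk_left

end Statistics

variable {M : Model Θ K T} {R : LPSolver M} {d : ℝ}

/-- The probability that the season that follows the history `h` offers price number `k` in
period `i`. -/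
noncomputable def offerProb (ρ : (s : ℕ) → Kernel (History K T s) Θ)
    (R : LPSolver M) (i : Fin T) (k : Fin K) {s : ℕ}
    (h : History K T s) : ℝ := ∫ θ', R.x θ' i k ∂(ρ s h)

theorem offerProb_nonneg (ρ : (s : ℕ) → Kernel (History K T s) Θ) (i : Fin T) (k : Fin K) {s : ℕ}
    (h : History K T s) : 0 ≤ offerProb ρ R i k h := integral_nonneg fun _ => R.x_nonneg _ _ _

theorem ae_tsHistoryKernel (ρ : (s : ℕ) → Kernel (History K T s) Θ) (hd : 0 ≤ d)
    (hM : M.DemandBounded d) (s : ℕ) (θ : Θ) :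
    ∀ᵐ h ∂(tsHistoryKernel M R ρ s θ), ∀ j, clipPast d (h j) = h j := by
  have hms : ∀ s, MeasurableSet {h : History K T s | ∀ j, clipPast d (h j) = h j} := fun s =>
    by
      simp only [Set.ofPred_forall]
      exact MeasurableSet.iInter fun j => (Model.measurableSet_clipPast_eq (K := K) (t := T) d).preimage
        (measurable_pi_apply j)
  induction s with
  | zero => exact .of_forall fun h j => j.elim0
  | succ s ih =>
    rw [tsHistoryKernel, Kernel.map_apply _ measurable_append,
      ae_map_iff measurable_append.aemeasurable (hms _)]
    refine Kernel.ae_compProd_of_ae_ae (measurable_append (hms _)) ?_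
    filter_upwards [ih] with h hh
    have h1 : ∀ᵐ q ∂(tsSeasonKernel M R (ρ s) (θ, h)), clipPast d q = q := by
      rw [tsSeasonKernel]
      refine Kernel.ae_comp_of_ae_ae (Model.measurableSet_clipPast_eq d) ?_
      exact .of_forall fun p => Model.ae_clipPast_eq hd hM R.policy T le_rfl p
    filter_upwards [h1] with q hq
    intro j
    refine Fin.lastCases ?_ (fun l => ?_) j
    · rw [append_last]; exact hq
    · rw [append_castSucc]; exact hh l

section Kernels

variable (ρ : (s : ℕ) → Kernel (History K T s) Θ) [hρ : ∀ s, IsMarkovKernel (ρ s)]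

instance isMarkovKernel_tsSeasonKernel {s : ℕ} :
    IsMarkovKernel (tsSeasonKernel M R (ρ s)) := by
  unfold tsSeasonKernel; infer_instance

instance isMarkovKernel_tsHistoryKernel (s : ℕ) : IsMarkovKernel (tsHistoryKernel M R ρ s) := by
  induction s with
  | zero => unfold tsHistoryKernel; infer_instance
  | succ s ih => exact Kernel.IsMarkovKernel.map _ measurable_append

theorem tsSeasonKernel_input_apply {s : ℕ} (θ : Θ) (h : History K T s) :
    (Kernel.deterministic (Prod.fst : Θ × History K T s → Θ) measurable_fst ×ₖ
      (ρ s).comap (Prod.snd : Θ × History K T s → History K T s) measurable_snd) (θ, h) =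
      (ρ s h).map (Prod.mk θ) := by
  rw [Kernel.prod_apply, Kernel.deterministic_apply, Kernel.comap_apply, Measure.dirac_prod]

theorem integral_tsSeasonKernel {s : ℕ} (θ : Θ) (h : History K T s) {g : Past K T → ℝ}
    (hg : BoundedMeasurable g) :
    ∫ q, g q ∂(tsSeasonKernel M R (ρ s) (θ, h)) =
      ∫ θ', ∫ q, g q ∂(M.seasonKernel R.policy T le_rfl (θ, θ')) ∂(ρ s h) := by
  have h2 : IsMarkovKernel (M.seasonKernel R.policy T le_rfl ∘ₖ
    (Kernel.deterministic (Prod.fst : Θ × History K T s → Θ) measurable_fst ×ₖ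
      (ρ s).comap (Prod.snd : Θ × History K T s → History K T s) measurable_snd)) := inferInstance
  rw [tsSeasonKernel, Kernel.integral_comp (hg.integrable _), tsSeasonKernel_input_apply]
  exact integral_map measurable_prodMk_left.aemeasurable
    ((hg.comp measurable_snd).integral_kernel
      (M.seasonKernel R.policy T le_rfl)).meas.aestronglyMeasurable

theorem integral_tsHistoryKernel_zero (θ : Θ) (g : History K T 0 → ℝ) :
    ∫ h, g h ∂(tsHistoryKernel M R ρ 0 θ) = g Fin.elim0 := by
  have : ∀ h : History K T 0, h = Fin.elim0 := fun h => Subsingleton.elim _ _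
  rw [integral_congr_ae (g := fun _ => g Fin.elim0) (.of_forall fun h => by rw [this h])]
  simp

theorem integral_tsHistoryKernel_succ {s : ℕ} (θ : Θ) {g : History K T (s + 1) → ℝ}
    (hg : BoundedMeasurable g) :
    ∫ h, g h ∂(tsHistoryKernel M R ρ (s + 1) θ) =
      ∫ h, ∫ θ', ∫ q, g (append (h, q)) ∂(M.seasonKernel R.policy T le_rfl (θ, θ')) ∂(ρ s h)
        ∂(tsHistoryKernel M R ρ s θ) := by
  have hga : BoundedMeasurable fun z : History K T s × Past K T => g (append z) :=
    hg.comp measurable_append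
  rw [tsHistoryKernel, Kernel.map_apply _ measurable_append,
    integral_map measurable_append.aemeasurable hg.meas.aestronglyMeasurable,
    integral_kernel_compProd _ _ hga]
  exact integral_congr_ae (.of_forall fun h =>
    integral_tsSeasonKernel ρ θ h (hga.comp measurable_prodMk_left))

theorem boundedMeasurable_offerProb (i : Fin T) (k : Fin K) {s : ℕ} :
    BoundedMeasurable fun h : History K T s => offerProb ρ R i k h :=
  ((R.boundedMeasurable_x i k).comp measurable_snd).integral_kernel (ρ s)

/-- The evolution of a function of the two statistics of one price over one season. -/
theorem integral_arm_succ (hd : 0 ≤ d) (hM : M.DemandBounded d) (i : Fin T) (k : Fin K) {s : ℕ}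
    {Ψ : ℕ → ℝ → ℝ} (hΨ : ∀ n, Continuous (Ψ n)) (θ : Θ) :
    ∫ h, Ψ (pulls i k h) (pullDeviation M d i k θ h) ∂(tsHistoryKernel M R ρ (s + 1) θ) =
      ∫ h, (Ψ (pulls i k h) (pullDeviation M d i k θ h) + offerProb ρ R i k h *
        (∫ y, Ψ (pulls i k h + 1)
            (pullDeviation M d i k θ h + (clip d y - M.meanDemand θ i k) / d) ∂(M.demand i k θ) -
          Ψ (pulls i k h) (pullDeviation M d i k θ h))) ∂(tsHistoryKernel M R ρ s θ) := by
  rw [integral_tsHistoryKernel_succ ρ θ (boundedMeasurable_arm_right hd hM i k hΨ θ)]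
  refine integral_congr_ae (.of_forall fun h => ?_)
  simp only [pulls_append, pullDeviation_append]
  set n := pulls i k h
  set x := pullDeviation M d i k θ h
  have hg : BoundedMeasurable fun o : Obs K => Ψ (n + if o.1 = some k then 1 else 0)
      (x + if o.1 = some k then (clip d o.2 - M.meanDemand θ i k) / d else 0) := by
    have hms : MeasurableSet {o : Obs K | o.1 = some k} :=
      measurable_fst (measurableSet_singleton (some k))
    refine .comp_nat hΨ (N := fun o => n + if o.1 = some k then 1 else 0) (s := n + 1) (measurable_const.add
      (Measurable.ite hms measurable_const measurable_const)) (fun o => ?_)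
      (.add (.const _) (.ite hms ?_ (.const 0)))
    · split_ifs <;> omega
    · simp only [div_eq_inv_mul]
      exact .const_mul _ (.sub (LPSolver.boundedMeasurable_clip_snd hd) (.const _))
  have hin : ∀ θ', ∫ q, Ψ (n + if (q i).1 = some k then 1 else 0)
      (x + if (q i).1 = some k then (clip d (q i).2 - M.meanDemand θ i k) / d else 0)
      ∂(M.seasonKernel R.policy T le_rfl (θ, θ')) = Ψ n x + R.x θ' i k *
        (∫ y, Ψ (n + 1) (x + (clip d y - M.meanDemand θ i k) / d) ∂(M.demand i k θ) - Ψ n x) := by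
    intro θ'
    rw [R.integral_seasonKernel_period le_rfl (θ, θ') i hg, R.integral_periodLaw _ _ hg]
    simp only [Option.some.injEq, reduceCtorEq, if_false, add_zero, Fin.castLE_rfl, id]
    have h1 : ∀ k' : Fin K, R.x θ' i k' * ∫ y, Ψ (n + if k' = k then 1 else 0)
        (x + if k' = k then (clip d y - M.meanDemand θ i k) / d else 0) ∂(M.demand i k' θ) =
        R.x θ' i k' * Ψ n x + if k' = k then R.x θ' i k *
        (∫ y, Ψ (n + 1) (x + (clip d y - M.meanDemand θ i k) / d) ∂(M.demand i k θ) - Ψ n x)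
        else 0 := by
      intro k'
      split_ifs with hk
      · subst hk; ring
      · simp
    simp only [h1]
    rw [Finset.sum_add_distrib, ← Finset.sum_mul, Finset.sum_ite_eq', if_pos (Finset.mem_univ _)]
    ring
  simp only [hin]
  rw [integral_add (integrable_const _) (((R.boundedMeasurable_x i k).integrable _).mul_const _),
    integral_mul_const]
  simp [offerProb]

theorem integral_exp_le (hd : 0 < d) (hM : M.DemandBounded d) (i : Fin T) (k : Fin K) (θ : Θ)
    (μ : ℝ) : ∫ y, Real.exp (μ * ((clip d y - M.meanDemand θ i k) / d)) ∂(M.demand i k θ) ≤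
      Real.exp (μ ^ 2 / 8) := by
  have h1 := hasSubgaussianMGF_of_mem_Icc (μ := M.demand i k θ) (X := fun y => clip d y / d)
    (a := 0) (b := 1) ((measurable_clip d).div_const d).aemeasurable
    (.of_forall fun y => ⟨div_nonneg (clip_nonneg _ _) hd.le, (div_le_one hd).2 (clip_le hd.le y)⟩)
  have h2 := h1.mgf_le μ
  rw [mgf, integral_div, ← Model.meanDemand_eq_clip hM] at h2
  simp only [← sub_div] at h2
  refine h2.trans (le_of_eq ?_)
  congr 1
  norm_num
  ring

theorem integral_expWeight_succ_le (hd : 0 < d) (hM : M.DemandBounded d) (i : Fin T) (k : Fin K)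
    (θ : Θ) (μ : ℝ) (n : ℕ) (x : ℝ) :
    ∫ y, expWeight μ (n + 1) (x + (clip d y - M.meanDemand θ i k) / d) ∂(M.demand i k θ) ≤
      expWeight μ n x := by
  have h1 : ∀ y, expWeight μ (n + 1) (x + (clip d y - M.meanDemand θ i k) / d) =
      expWeight μ n x * Real.exp (-(μ ^ 2 / 8)) *
        Real.exp (μ * ((clip d y - M.meanDemand θ i k) / d)) := by
    intro y
    rw [expWeight, expWeight, ← Real.exp_add, ← Real.exp_add]
    congr 1
    push_cast
    ring
  simp only [h1]
  rw [integral_const_mul]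
  calc _ ≤ expWeight μ n x * Real.exp (-(μ ^ 2 / 8)) * Real.exp (μ ^ 2 / 8) :=
        mul_le_mul_of_nonneg_left (integral_exp_le hd hM i k θ μ)
          (mul_nonneg (expWeight_nonneg _ _ _) (Real.exp_pos _).le)
    _ = _ := by rw [mul_assoc, ← Real.exp_add]; simp

theorem boundedMeasurable_arm_next (hd : 0 ≤ d) (hM : M.DemandBounded d) (i : Fin T) (k : Fin K)
    {s : ℕ} {Ψ : ℕ → ℝ → ℝ} (hΨ : ∀ n, Continuous (Ψ n)) (θ : Θ) :
    BoundedMeasurable fun h : History K T s => ∫ y, Ψ (pulls i k h + 1)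
      (pullDeviation M d i k θ h + (clip d y - M.meanDemand θ i k) / d) ∂(M.demand i k θ) := by
  have h1 : BoundedMeasurable fun z : History K T s × ℝ => Ψ (pulls i k z.1 + 1)
      (pullDeviation M d i k θ z.1 + (clip d z.2 - M.meanDemand θ i k) / d) := by
    refine .comp_nat (N := fun z : History K T s × ℝ => pulls i k z.1 + 1) (s := s + 1) hΨ
      (((measurable_pulls i k).comp measurable_fst).add measurable_const)
      (fun z => Nat.succ_le_succ (pulls_le i k z.1)) (.add ?_ ?_)
    · exact (boundedMeasurable_pullDeviation hd hM i k).comp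
        (measurable_const.prodMk measurable_fst)
    · simp only [div_eq_inv_mul]
      exact .const_mul _ (.sub ((boundedMeasurable_clip hd).comp measurable_snd) (.const _))
  exact h1.integral_kernel (Kernel.const _ (M.demand i k θ))

/-- The drop of the expectation of a potential bounds the expectation of what the potential pays
whenever the price is offered. -/
theorem integral_offerProb_mul_le (hd : 0 ≤ d) (hM : M.DemandBounded d) (i : Fin T) (k : Fin K)
    {s : ℕ} {Ψ φ : ℕ → ℝ → ℝ} (hΨ : ∀ n, Continuous (Ψ n)) (hφ : ∀ n, Continuous (φ n)) (θ : Θ)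
    (h : ∀ n x, ∫ y, Ψ (n + 1) (x + (clip d y - M.meanDemand θ i k) / d) ∂(M.demand i k θ) +
      φ n x ≤ Ψ n x) :
    ∫ h, offerProb ρ R i k h * φ (pulls i k h) (pullDeviation M d i k θ h)
        ∂(tsHistoryKernel M R ρ s θ) ≤
      ∫ h, Ψ (pulls i k h) (pullDeviation M d i k θ h) ∂(tsHistoryKernel M R ρ s θ) -
      ∫ h, Ψ (pulls i k h) (pullDeviation M d i k θ h) ∂(tsHistoryKernel M R ρ (s + 1) θ) := by
  have hΨm := boundedMeasurable_arm_right (s := s) hd hM i k hΨ θ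
  have hw := boundedMeasurable_offerProb ρ (R := R) i k (s := s)
  have hstep := hw.mul ((boundedMeasurable_arm_next (s := s) hd hM i k hΨ θ).sub hΨm)
  rw [integral_arm_succ ρ hd hM i k hΨ θ, ← integral_sub (hΨm.integrable _)
    ((hΨm.add hstep).integrable _)]
  refine integral_mono ((hw.mul (boundedMeasurable_arm_right hd hM i k hφ θ)).integrable _)
    ((hΨm.sub (hΨm.add hstep)).integrable _) fun g => ?_
  have := mul_le_mul_of_nonneg_left (h (pulls i k g) (pullDeviation M d i k θ g))
    (offerProb_nonneg ρ (R := R) i k g)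
  dsimp only
  linarith

theorem pulls_zero (i : Fin T) (k : Fin K) (h : History K T 0) : pulls i k h = 0 := by
  simp [pulls]

theorem pullDeviation_zero (i : Fin T) (k : Fin K) (θ : Θ) (h : History K T 0) :
    pullDeviation M d i k θ h = 0 := by
  simp [pullDeviation]

theorem sum_integral_offerProb_mul_le (hd : 0 ≤ d) (hM : M.DemandBounded d) (i : Fin T) (k : Fin K)
    (S : ℕ) {Ψ φ : ℕ → ℝ → ℝ} (hΨ : ∀ n, Continuous (Ψ n)) (hφ : ∀ n, Continuous (φ n)) (θ : Θ)
    (h : ∀ n x, ∫ y, Ψ (n + 1) (x + (clip d y - M.meanDemand θ i k) / d) ∂(M.demand i k θ) +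
      φ n x ≤ Ψ n x) :
    ∑ s ∈ Finset.range S, ∫ h, offerProb ρ R i k h * φ (pulls i k h) (pullDeviation M d i k θ h)
        ∂(tsHistoryKernel M R ρ s θ) ≤
      Ψ 0 0 - ∫ h, Ψ (pulls i k h) (pullDeviation M d i k θ h) ∂(tsHistoryKernel M R ρ S θ) := by
  refine (Finset.sum_le_sum fun s _ =>
    integral_offerProb_mul_le ρ (R := R) hd hM i k (s := s) hΨ hφ θ h).trans ?_
  rw [Finset.sum_range_sub' (fun s => ∫ h, Ψ (pulls i k h) (pullDeviation M d i k θ h)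
    ∂(tsHistoryKernel M R ρ s θ)) S, integral_tsHistoryKernel_zero, pulls_zero, pullDeviation_zero]

theorem integral_expWeight_le_one (hd : 0 < d) (hM : M.DemandBounded d) (i : Fin T) (k : Fin K)
    (s : ℕ) (θ : Θ) (μ : ℝ) :
    ∫ h, expWeight μ (pulls i k h) (pullDeviation M d i k θ h)
      ∂(tsHistoryKernel M R ρ s θ) ≤ 1 := by
  have := sum_integral_offerProb_mul_le ρ (R := R) hd.le hM i k s (Ψ := expWeight μ)
    (φ := fun _ _ => 0) (continuous_expWeight μ) (fun _ => continuous_const) θ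
    fun n x => by simpa using integral_expWeight_succ_le hd hM i k θ μ n x
  simpa [expWeight] using this

theorem sum_integral_offerProb_expWeight_le_one (hd : 0 < d) (hM : M.DemandBounded d) (i : Fin T)
    (k : Fin K) (S : ℕ) (θ : Θ) (μ : ℝ) (l : ℕ) :
    ∑ s ∈ Finset.range S, ∫ h, offerProb ρ R i k h *
        (if pulls i k h = l then expWeight μ (pulls i k h) (pullDeviation M d i k θ h) else 0)
        ∂(tsHistoryKernel M R ρ s θ) ≤ 1 := by
  have := sum_integral_offerProb_mul_le ρ (R := R) hd.le hM i k S
    (Ψ := fun n x => if n ≤ l then expWeight μ n x else 0)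
    (φ := fun n x => if n = l then expWeight μ n x else 0)
    (fun n => by split_ifs; exacts [continuous_expWeight μ n, continuous_const])
    (fun n => by split_ifs; exacts [continuous_expWeight μ n, continuous_const]) θ
    fun n x => by
      rcases lt_trichotomy n l with hn | hn | hn
      · simp only [if_pos (show n + 1 ≤ l from hn), if_neg hn.ne, if_pos hn.le, add_zero]
        exact integral_expWeight_succ_le hd hM i k θ μ n x
      · simp [hn]
      · simp [hn.ne', not_le.2 hn, not_le.2 (Nat.lt_succ_of_lt hn)]
  refine this.trans ?_
  have h0 : 0 ≤ ∫ h, (if pulls i k h ≤ l then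
      expWeight μ (pulls i k h) (pullDeviation M d i k θ h) else 0)
      ∂(tsHistoryKernel M R ρ S θ) :=
    integral_nonneg fun h => by
      dsimp only
      split_ifs
      exacts [expWeight_nonneg _ _ _, le_rfl]
  simp only [Nat.zero_le, if_true]
  have : expWeight μ 0 0 = 1 := by simp [expWeight]
  linarith

theorem sum_integral_offerProb_radius_le (hd : 0 ≤ d) (hM : M.DemandBounded d) (i : Fin T)
    (k : Fin K) (S : ℕ) (θ : Θ) (r : ℕ → ℝ) :
    ∑ s ∈ Finset.range S, ∫ h, offerProb ρ R i k h * r (pulls i k h)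
        ∂(tsHistoryKernel M R ρ s θ) ≤
      ∫ h, ∑ l ∈ Finset.range (pulls i k h), r l ∂(tsHistoryKernel M R ρ S θ) := by
  have := sum_integral_offerProb_mul_le ρ (R := R) hd hM i k S
    (Ψ := fun n _ => -∑ l ∈ Finset.range n, r l) (φ := fun n _ => r n)
    (fun _ => continuous_const) (fun _ => continuous_const) θ
    fun n x => by simp [Finset.sum_range_succ]
  simpa [integral_neg] using this

end Kernels

end EpisodicRM

namespace EpisodicRM

variable {Θ : Type*} [MeasurableSpace Θ] {K T : ℕ} {M : Model Θ K T} {R : LPSolver M} {d : ℝ}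

/-- The error bound for the empirical mean of `n` demands whose centred sum is `x`, in units of
the largest demand. -/
noncomputable def meanError (n : ℕ) (x : ℝ) : ℝ := if n = 0 then 1 else |x| / n

/-- The part of the error of the empirical mean that exceeds the radius `r n`. -/
noncomputable def excessError (r : ℕ → ℝ) (n : ℕ) (x : ℝ) : ℝ := max (meanError n x - r n) 0

theorem continuous_meanError (n : ℕ) : Continuous (meanError n) := by
  unfold meanError
  split_ifs
  · exact continuous_const
  · fun_prop

theorem continuous_excessError (r : ℕ → ℝ) (n : ℕ) : Continuous (excessError r n) :=
  ((continuous_meanError n).sub continuous_const).max continuous_const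

/-- The average of the observed demands of period `i` under price number `k`. -/
noncomputable def empiricalMean (d : ℝ) (i : Fin T) (k : Fin K) {s : ℕ} (h : History K T s) : ℝ :=
  (∑ j, if (h j i).1 = some k then clip d (h j i).2 else 0) / pulls i k h

theorem abs_meanDemand_sub_empiricalMean_le (hd : 0 < d) (hM : M.DemandBounded d) (θ : Θ)
    (i : Fin T) (k : Fin K) {s : ℕ} (h : History K T s) :
    |M.meanDemand θ i k - empiricalMean d i k h| ≤
      d * meanError (pulls i k h) (pullDeviation M d i k θ h) := by
  have hm := Model.meanDemand_mem hd.le hM θ i k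
  rw [meanError]
  split_ifs with h0
  · rw [empiricalMean, h0]
    simp only [Nat.cast_zero, div_zero, sub_zero, mul_one]
    rw [abs_of_nonneg hm.1]
    exact hm.2
  · have hn : (pulls i k h : ℝ) ≠ 0 := Nat.cast_ne_zero.2 h0
    have hx : pullDeviation M d i k θ h = ((∑ j, if (h j i).1 = some k then clip d (h j i).2 else 0) -
        pulls i k h * M.meanDemand θ i k) / d := by
      rw [pullDeviation, pulls, Nat.cast_sum, Finset.sum_mul, ← Finset.sum_sub_distrib,
        Finset.sum_div]
      refine Finset.sum_congr rfl fun j _ => ?_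
      split_ifs <;> simp
    have hn' : (0 : ℝ) < pulls i k h := lt_of_le_of_ne (Nat.cast_nonneg _) hn.symm
    rw [hx, empiricalMean, abs_div, abs_of_pos hd, abs_sub_comm]
    set Y := ∑ j, if (h j i).1 = some k then clip d (h j i).2 else 0
    have e : Y / (pulls i k h : ℝ) - M.meanDemand θ i k =
      (Y - pulls i k h * M.meanDemand θ i k) / pulls i k h := by field_simp
    rw [e, abs_div, abs_of_pos hn']
    apply le_of_eq
    field_simp

theorem abs_meanDemand_sub_le (hd : 0 < d) (hM : M.DemandBounded d) (r : ℕ → ℝ) (θ θ' : Θ)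
    (i : Fin T) (k : Fin K) {s : ℕ} (h : History K T s) :
    |M.meanDemand θ' i k - M.meanDemand θ i k| ≤
      d * (2 * r (pulls i k h) + excessError r (pulls i k h) (pullDeviation M d i k θ h)) +
      d * excessError r (pulls i k h) (pullDeviation M d i k θ' h) := by
  have h1 := abs_meanDemand_sub_empiricalMean_le hd hM θ i k h
  have h2 := abs_meanDemand_sub_empiricalMean_le hd hM θ' i k h
  have h3 := abs_sub_le (M.meanDemand θ' i k) (empiricalMean d i k h) (M.meanDemand θ i k)
  rw [abs_sub_comm (empiricalMean d i k h)] at h3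
  have h4 := mul_le_mul_of_nonneg_left
    (le_max_left (meanError (pulls i k h) (pullDeviation M d i k θ h) - r (pulls i k h)) 0) hd.le
  have h5 := mul_le_mul_of_nonneg_left
    (le_max_left (meanError (pulls i k h) (pullDeviation M d i k θ' h) - r (pulls i k h)) 0) hd.le
  rw [excessError, excessError]
  linarith

section FixedParameter

variable (ρ : (s : ℕ) → Kernel (History K T s) Θ) [hρ : ∀ s, IsMarkovKernel (ρ s)]

theorem sum_integral_offerProb_excess_le (hd : 0 < d) (hM : M.DemandBounded d) (i : Fin T)
    (k : Fin K) (S : ℕ) (θ : Θ) {r c μ : ℕ → ℝ} (hc : ∀ n, 0 ≤ c n)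
    (h : ∀ n < S, ∀ x, excessError r n x ≤
      c n * (expWeight (μ n) n x + expWeight (-μ n) n x)) :
    ∑ s ∈ Finset.range S, ∫ h, offerProb ρ R i k h *
        excessError r (pulls i k h) (pullDeviation M d i k θ h) ∂(tsHistoryKernel M R ρ s θ) ≤
      2 * ∑ l ∈ Finset.range S, c l := by
  have hif : ∀ l μ', ∀ n, Continuous fun x => if n = l then expWeight μ' n x else 0 :=
    fun l μ' n => by split_ifs; exacts [continuous_expWeight _ n, continuous_const]
  have hb : ∀ s l μ', BoundedMeasurable fun h : History K T s => offerProb ρ R i k h *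
      (if pulls i k h = l then expWeight μ' (pulls i k h) (pullDeviation M d i k θ h) else 0) :=
    fun s l μ' => (boundedMeasurable_offerProb ρ i k).mul
      (boundedMeasurable_arm_right hd.le hM i k (hif l μ') θ)
  have h1 : ∀ s ∈ Finset.range S, ∫ h, offerProb ρ R i k h *
      excessError r (pulls i k h) (pullDeviation M d i k θ h) ∂(tsHistoryKernel M R ρ s θ) ≤
      ∑ l ∈ Finset.range S, (c l * ∫ h, offerProb ρ R i k h * (if pulls i k h = l then
          expWeight (μ l) (pulls i k h) (pullDeviation M d i k θ h) else 0)
          ∂(tsHistoryKernel M R ρ s θ) +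
        c l * ∫ h, offerProb ρ R i k h * (if pulls i k h = l then
          expWeight (-μ l) (pulls i k h) (pullDeviation M d i k θ h) else 0)
          ∂(tsHistoryKernel M R ρ s θ)) := by
    intro s hs
    simp only [← integral_const_mul]
    rw [Finset.sum_congr rfl fun l _ => (integral_add (((hb s l (μ l)).const_mul _).integrable _)
      (((hb s l (-μ l)).const_mul _).integrable _)).symm, ← integral_finsetSum _ fun l _ =>
      (((hb s l (μ l)).const_mul _).add ((hb s l (-μ l)).const_mul _)).integrable _]
    refine integral_mono (((boundedMeasurable_offerProb ρ i k).mul (boundedMeasurable_arm_right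
      hd.le hM i k (continuous_excessError r) θ)).integrable _) ((BoundedMeasurable.sum _ fun l _ =>
      ((hb s l (μ l)).const_mul _).add ((hb s l (-μ l)).const_mul _)).integrable _) fun g => ?_
    have hn : pulls i k g < S := (pulls_le i k g).trans_lt (Finset.mem_range.1 hs)
    dsimp only
    rw [Finset.sum_eq_single_of_mem (pulls i k g) (Finset.mem_range.2 hn)
      fun l _ hl => by simp [hl.symm]]
    simp only [if_true]
    have := mul_le_mul_of_nonneg_left (h _ hn (pullDeviation M d i k θ g))
      (offerProb_nonneg ρ (R := R) i k g)
    linarith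
  refine (Finset.sum_le_sum h1).trans ?_
  rw [Finset.sum_comm, Finset.mul_sum]
  refine Finset.sum_le_sum fun l _ => ?_
  rw [Finset.sum_add_distrib, ← Finset.mul_sum, ← Finset.mul_sum]
  have h2 := mul_le_mul_of_nonneg_left
    (sum_integral_offerProb_expWeight_le_one ρ (R := R) hd hM i k S θ (μ l) l) (hc l)
  have h3 := mul_le_mul_of_nonneg_left
    (sum_integral_offerProb_expWeight_le_one ρ (R := R) hd hM i k S θ (-μ l) l) (hc l)
  linarith

theorem boundedMeasurable_learning (hd : 0 < d) (hM : M.DemandBounded d) (i : Fin T) (θ : Θ)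
    (s : ℕ) (r : ℕ → ℝ) (k : Fin K) : BoundedMeasurable fun h : History K T s =>
      offerProb ρ R i k h * (2 * r (pulls i k h) +
        excessError r (pulls i k h) (pullDeviation M d i k θ h)) :=
  (boundedMeasurable_offerProb ρ i k).mul (boundedMeasurable_arm_right hd.le hM i k
    (Ψ := fun n x => 2 * r n + excessError r n x)
    (fun n => continuous_const.add (continuous_excessError r n)) θ)

/-- The error of the empirical means of the offered prices, summed over all seasons. -/
theorem sum_integral_learning_le (hd : 0 < d) (hM : M.DemandBounded d) (i : Fin T) (S : ℕ) (θ : Θ)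
    {r c μ : ℕ → ℝ} (hc : ∀ n, 0 ≤ c n)
    (h : ∀ n < S, ∀ x, excessError r n x ≤
      c n * (expWeight (μ n) n x + expWeight (-μ n) n x)) {a b : ℝ} (hb : 0 ≤ b)
    (hr : ∀ n, ∑ l ∈ Finset.range n, r l ≤ a + b * n) :
    ∑ s ∈ Finset.range S, ∫ h, ∑ k, offerProb ρ R i k h * (2 * r (pulls i k h) +
        excessError r (pulls i k h) (pullDeviation M d i k θ h)) ∂(tsHistoryKernel M R ρ s θ) ≤
      2 * (K * a + b * S) + K * (2 * ∑ l ∈ Finset.range S, c l) := by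
  have hrad : ∀ s k, BoundedMeasurable fun h : History K T s =>
      offerProb ρ R i k h * r (pulls i k h) := fun s k =>
    (boundedMeasurable_offerProb ρ i k).mul (boundedMeasurable_arm_right hd.le hM i k
      (Ψ := fun n _ => r n) (fun n => continuous_const) θ)
  have hexc : ∀ s k, BoundedMeasurable fun h : History K T s =>
      offerProb ρ R i k h * excessError r (pulls i k h) (pullDeviation M d i k θ h) := fun s k =>
    (boundedMeasurable_offerProb ρ i k).mul (boundedMeasurable_arm_right hd.le hM i k
      (continuous_excessError r) θ)
  have h1 : ∀ s, ∫ h, ∑ k, offerProb ρ R i k h * (2 * r (pulls i k h) +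
        excessError r (pulls i k h) (pullDeviation M d i k θ h)) ∂(tsHistoryKernel M R ρ s θ) =
      ∑ k, (2 * ∫ h, offerProb ρ R i k h * r (pulls i k h) ∂(tsHistoryKernel M R ρ s θ) +
        ∫ h, offerProb ρ R i k h * excessError r (pulls i k h) (pullDeviation M d i k θ h)
          ∂(tsHistoryKernel M R ρ s θ)) := by
    intro s
    rw [integral_finsetSum _ fun k _ =>
      (boundedMeasurable_learning ρ hd hM i θ s r k).integrable _]
    refine Finset.sum_congr rfl fun k _ => ?_
    rw [← integral_const_mul, ← integral_add (((hrad s k).const_mul _).integrable _)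
      ((hexc s k).integrable _)]
    exact integral_congr_ae (.of_forall fun h => by ring)
  simp only [h1]
  rw [Finset.sum_comm]
  simp only [Finset.sum_add_distrib, ← Finset.mul_sum]
  have hsum : ∀ k, BoundedMeasurable fun h : History K T S =>
      ∑ l ∈ Finset.range (pulls i k h), r l := fun k =>
    boundedMeasurable_arm_right hd.le hM i k (Ψ := fun n _ => ∑ l ∈ Finset.range n, r l)
      (fun n => continuous_const) θ
  have h2 : ∑ k, ∑ s ∈ Finset.range S, ∫ h, offerProb ρ R i k h * r (pulls i k h)
      ∂(tsHistoryKernel M R ρ s θ) ≤ K * a + b * S := by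
    refine (Finset.sum_le_sum fun k _ =>
      sum_integral_offerProb_radius_le ρ (R := R) hd.le hM i k S θ r).trans ?_
    rw [← integral_finsetSum _ fun k _ => (hsum k).integrable _]
    calc _ ≤ ∫ _, (K * a + b * S) ∂(tsHistoryKernel M R ρ S θ) := by
          refine integral_mono ((BoundedMeasurable.sum _ fun k _ => hsum k).integrable _)
            (integrable_const _) fun h => (Finset.sum_le_sum fun k _ => hr (pulls i k h)).trans ?_
          rw [Finset.sum_add_distrib, ← Finset.mul_sum]
          simp only [Finset.sum_const, Finset.card_univ, Fintype.card_fin, nsmul_eq_mul]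
          refine add_le_add_right (mul_le_mul_of_nonneg_left ?_ hb) _
          exact_mod_cast sum_pulls_le i h
      _ = _ := by simp
  have h3 : ∑ k : Fin K, ∑ s ∈ Finset.range S, ∫ h, offerProb ρ R i k h *
      excessError r (pulls i k h) (pullDeviation M d i k θ h) ∂(tsHistoryKernel M R ρ s θ) ≤
      K * (2 * ∑ l ∈ Finset.range S, c l) := by
    refine (Finset.sum_le_sum fun k _ =>
      sum_integral_offerProb_excess_le ρ (R := R) hd hM i k S θ hc h).trans ?_
    simp
  linarith

/-- The excess error of the prices that are offered with fixed probabilities. -/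
theorem integral_excess_le_of_scales (hd : 0 < d) (hM : M.DemandBounded d) (i : Fin T) {s J : ℕ}
    (θ : Θ) {r c μ : ℕ → ℝ} (hc : ∀ j, 0 ≤ c j)
    (h : ∀ n ≤ s, ∀ x, excessError r n x ≤
      ∑ j ∈ Finset.range J, c j * (expWeight (μ j) n x + expWeight (-μ j) n x))
    {w : Fin K → ℝ} (hw : ∀ k, 0 ≤ w k) (hw1 : ∑ k, w k ≤ 1) :
    ∫ h, ∑ k, w k * excessError r (pulls i k h) (pullDeviation M d i k θ h)
        ∂(tsHistoryKernel M R ρ s θ) ≤ 2 * ∑ j ∈ Finset.range J, c j := by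
  have hb : ∀ k μ', BoundedMeasurable fun h : History K T s =>
      expWeight μ' (pulls i k h) (pullDeviation M d i k θ h) := fun k μ' =>
    boundedMeasurable_arm_right hd.le hM i k (continuous_expWeight μ') θ
  have hexc : ∀ k, BoundedMeasurable fun h : History K T s =>
      excessError r (pulls i k h) (pullDeviation M d i k θ h) := fun k =>
    boundedMeasurable_arm_right hd.le hM i k (continuous_excessError r) θ
  rw [integral_finsetSum _ fun k _ => ((hexc k).const_mul _).integrable _]
  have h1 : ∀ k, ∫ h, excessError r (pulls i k h) (pullDeviation M d i k θ h)
      ∂(tsHistoryKernel M R ρ s θ) ≤ 2 * ∑ j ∈ Finset.range J, c j := by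
    intro k
    calc _ ≤ ∫ h, ∑ j ∈ Finset.range J, c j *
          (expWeight (μ j) (pulls i k h) (pullDeviation M d i k θ h) +
            expWeight (-μ j) (pulls i k h) (pullDeviation M d i k θ h))
          ∂(tsHistoryKernel M R ρ s θ) :=
          integral_mono ((hexc k).integrable _) ((BoundedMeasurable.sum _ fun j _ =>
            ((hb k (μ j)).add (hb k (-μ j))).const_mul _).integrable _)
            fun g => h _ (pulls_le i k g) _
      _ = ∑ j ∈ Finset.range J, c j *
          (∫ h, expWeight (μ j) (pulls i k h) (pullDeviation M d i k θ h)
              ∂(tsHistoryKernel M R ρ s θ) +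
            ∫ h, expWeight (-μ j) (pulls i k h) (pullDeviation M d i k θ h)
              ∂(tsHistoryKernel M R ρ s θ)) := by
          rw [integral_finsetSum _ fun j _ =>
            (((hb k (μ j)).add (hb k (-μ j))).const_mul _).integrable _]
          refine Finset.sum_congr rfl fun j _ => ?_
          rw [integral_const_mul, integral_add ((hb k (μ j)).integrable _)
            ((hb k (-μ j)).integrable _)]
      _ ≤ _ := by
          rw [Finset.mul_sum]
          refine Finset.sum_le_sum fun j _ => ?_
          have h2 := integral_expWeight_le_one ρ (R := R) hd hM i k s θ (μ j)
          have h3 := integral_expWeight_le_one ρ (R := R) hd hM i k s θ (-μ j)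
          nlinarith [hc j]
  have h0 : 0 ≤ 2 * ∑ j ∈ Finset.range J, c j :=
    mul_nonneg zero_le_two (Finset.sum_nonneg fun j _ => hc j)
  calc _ ≤ ∑ k, w k * (2 * ∑ j ∈ Finset.range J, c j) :=
        Finset.sum_le_sum fun k _ => by
          rw [integral_const_mul]
          exact mul_le_mul_of_nonneg_left (h1 k) (hw k)
    _ ≤ _ := by
        rw [← Finset.sum_mul]
        exact mul_le_of_le_one_left h0 hw1

end FixedParameter

section Joint

variable (f : Measure Θ) [IsProbabilityMeasure f]

/-- The joint distribution of the true parameter, the history of the first `s` seasons, and the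
parameter sampled for the following season. -/
noncomputable def jointLaw (M : Model Θ K T) (R : LPSolver M) (f : Measure Θ)
    (ρ : (s : ℕ) → Kernel (History K T s) Θ) (s : ℕ) : Measure ((Θ × History K T s) × Θ) :=
  (f ⊗ₘ tsHistoryKernel M R ρ s) ⊗ₘ (ρ s).comap Prod.snd measurable_snd

variable (ρ : (s : ℕ) → Kernel (History K T s) Θ) [hρ : ∀ s, IsMarkovKernel (ρ s)]

instance isProbabilityMeasure_jointLaw (s : ℕ) :
    IsProbabilityMeasure (jointLaw M R f ρ s) := by
  unfold jointLaw; infer_instance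

theorem integral_jointLaw (s : ℕ) {g : (Θ × History K T s) × Θ → ℝ} (hg : BoundedMeasurable g) :
    ∫ z, g z ∂(jointLaw M R f ρ s) =
      ∫ θ, ∫ h, ∫ θ', g ((θ, h), θ') ∂(ρ s h) ∂(tsHistoryKernel M R ρ s θ) ∂f := by
  rw [jointLaw, Measure.integral_compProd (hg.integrable _), Measure.integral_compProd]
  · simp only [Kernel.comap_apply]
  · exact (hg.integral_kernel _).integrable _

theorem integral_jointLaw_fst (s : ℕ) {g : Θ × History K T s → ℝ} (hg : BoundedMeasurable g) :
    ∫ z, g z.1 ∂(jointLaw M R f ρ s) = ∫ θ, ∫ h, g (θ, h) ∂(tsHistoryKernel M R ρ s θ) ∂f := by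
  rw [integral_jointLaw f ρ s (hg.comp measurable_fst)]
  simp

/-- The true and the sampled parameter have the same joint distribution with the history. -/
theorem integral_jointLaw_swap {s : ℕ}
    (hpost : IsPosterior f (tsHistoryKernel M R ρ s) (ρ s)) {g : Θ × History K T s → ℝ}
    (hg : BoundedMeasurable g) :
    ∫ z, g (z.2, z.1.2) ∂(jointLaw M R f ρ s) = ∫ z, g z.1 ∂(jointLaw M R f ρ s) := by
  have hg' : BoundedMeasurable fun z : History K T s × Θ => g z.swap := hg.comp measurable_swap
  have hg2 : BoundedMeasurable fun z : (Θ × History K T s) × Θ => g (z.2, z.1.2) :=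
    hg.comp (by fun_prop)
  have h1 : ∫ z, g z.swap ∂((tsHistoryKernel M R ρ s ∘ₘ f) ⊗ₘ ρ s) =
      ∫ z, g (z.2, z.1.2) ∂(jointLaw M R f ρ s) := by
    rw [Measure.integral_compProd (hg'.integrable _), jointLaw, Measure.integral_compProd
      (hg2.integrable _),
      ← Measure.snd_compProd, Measure.snd, integral_map measurable_snd.aemeasurable]
    · rfl
    · exact (hg'.integral_kernel (ρ s)).meas.aestronglyMeasurable
  rw [← h1, ← hpost, integral_map measurable_swap.aemeasurable hg'.meas.aestronglyMeasurable,
    integral_jointLaw_fst f ρ s hg, Measure.integral_compProd]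
  · rfl
  · exact (hg'.comp measurable_swap).integrable _

theorem boundedMeasurable_demandError (hd : 0 ≤ d) (hM : M.DemandBounded d) (i : Fin T) {s : ℕ} :
    BoundedMeasurable fun z : (Θ × History K T s) × Θ => R.demandError (z.1.1, z.2) i :=
  .sum _ fun k _ => ((R.boundedMeasurable_x i k).comp measurable_snd).mul
    (((Model.boundedMeasurable_meanDemand hd hM i k).comp measurable_snd).sub
      ((Model.boundedMeasurable_meanDemand hd hM i k).comp
        (measurable_fst.comp measurable_fst))).abs

/-- The Bayesian estimation error of the mean demands of one period over all seasons. -/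
theorem sum_integral_demandError_le (hd : 0 < d) (hM : M.DemandBounded d) (i : Fin T) {S J : ℕ}
    (hpost : ∀ s < S, IsPosterior f (tsHistoryKernel M R ρ s) (ρ s))
    {r c μ c' μ' : ℕ → ℝ} (hc : ∀ j, 0 ≤ c j) (hc' : ∀ n, 0 ≤ c' n)
    (h : ∀ n ≤ S, ∀ x, excessError r n x ≤
      ∑ j ∈ Finset.range J, c j * (expWeight (μ j) n x + expWeight (-μ j) n x))
    (h' : ∀ n < S, ∀ x, excessError r n x ≤
      c' n * (expWeight (μ' n) n x + expWeight (-μ' n) n x)) {a b : ℝ} (hb : 0 ≤ b)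
    (hr : ∀ n, ∑ l ∈ Finset.range n, r l ≤ a + b * n) :
    ∑ s ∈ Finset.range S, ∫ z, R.demandError (z.1.1, z.2) i ∂(jointLaw M R f ρ s) ≤
      d * (2 * (K * a + b * S) + K * (2 * ∑ l ∈ Finset.range S, c' l) +
        S * (2 * ∑ j ∈ Finset.range J, c j)) := by
  have hL : ∀ s, BoundedMeasurable fun z : Θ × History K T s =>
      ∫ θ', ∑ k, R.x θ' i k * (2 * r (pulls i k z.2) +
        excessError r (pulls i k z.2) (pullDeviation M d i k z.1 z.2)) ∂(ρ s z.2) := by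
    intro s
    have h1 : BoundedMeasurable fun z : (Θ × History K T s) × Θ =>
        ∑ k, R.x z.2 i k * (2 * r (pulls i k z.1.2) +
        excessError r (pulls i k z.1.2) (pullDeviation M d i k z.1.1 z.1.2)) :=
      .sum _ fun k _ => ((R.boundedMeasurable_x i k).comp measurable_snd).mul
        ((boundedMeasurable_arm hd.le hM i k (Ψ := fun n x => 2 * r n + excessError r n x)
          (fun n => continuous_const.add (continuous_excessError r n))).comp measurable_fst)
    exact h1.integral_kernel ((ρ s).comap Prod.snd measurable_snd)
  have hLeq : ∀ (s : ℕ) (θ : Θ) (h : History K T s),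
      ∫ θ', ∑ k, R.x θ' i k * (2 * r (pulls i k h) +
        excessError r (pulls i k h) (pullDeviation M d i k θ h)) ∂(ρ s h) =
      ∑ k, offerProb ρ R i k h * (2 * r (pulls i k h) +
        excessError r (pulls i k h) (pullDeviation M d i k θ h)) := by
    intro s θ h
    rw [integral_finsetSum _ fun k _ =>
      ((R.boundedMeasurable_x i k).integrable _).mul_const _]
    simp only [integral_mul_const, offerProb]
  have hE : ∀ s, BoundedMeasurable fun z : Θ × History K T s =>
      ∑ k, R.x z.1 i k * excessError r (pulls i k z.2) (pullDeviation M d i k z.1 z.2) := fun s =>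
    .sum _ fun k _ => ((R.boundedMeasurable_x i k).comp measurable_fst).mul
      (boundedMeasurable_arm hd.le hM i k (continuous_excessError r))
  have hLj : ∀ s, BoundedMeasurable fun z : (Θ × History K T s) × Θ =>
      ∑ k, R.x z.2 i k * (2 * r (pulls i k z.1.2) +
        excessError r (pulls i k z.1.2) (pullDeviation M d i k z.1.1 z.1.2)) := fun s =>
    .sum _ fun k _ => ((R.boundedMeasurable_x i k).comp measurable_snd).mul
      ((boundedMeasurable_arm hd.le hM i k (Ψ := fun n x => 2 * r n + excessError r n x)
        (fun n => continuous_const.add (continuous_excessError r n))).comp measurable_fst)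
  have hEj : ∀ s, BoundedMeasurable fun z : (Θ × History K T s) × Θ =>
      ∑ k, R.x z.2 i k * excessError r (pulls i k z.1.2) (pullDeviation M d i k z.2 z.1.2) :=
    fun s => (hE s).comp (measurable_snd.prodMk (measurable_snd.comp measurable_fst))
  have hstep : ∀ s ∈ Finset.range S, ∫ z, R.demandError (z.1.1, z.2) i ∂(jointLaw M R f ρ s) ≤
      d * ∫ θ, (∫ h, ∑ k, offerProb ρ R i k h * (2 * r (pulls i k h) +
        excessError r (pulls i k h) (pullDeviation M d i k θ h)) ∂(tsHistoryKernel M R ρ s θ)) ∂f +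
      d * (2 * ∑ j ∈ Finset.range J, c j) := by
    intro s hs
    have hsS := Finset.mem_range.1 hs
    calc _ ≤ ∫ z, (d * (∑ k, R.x z.2 i k * (2 * r (pulls i k z.1.2) +
          excessError r (pulls i k z.1.2) (pullDeviation M d i k z.1.1 z.1.2))) +
          d * (∑ k, R.x z.2 i k *
            excessError r (pulls i k z.1.2) (pullDeviation M d i k z.2 z.1.2)))
          ∂(jointLaw M R f ρ s) := by
          refine integral_mono ((boundedMeasurable_demandError hd.le hM i).integrable _)
            ((((hLj s).const_mul d).add ((hEj s).const_mul d)).integrable _) fun z => ?_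
          simp only [LPSolver.demandError, Finset.mul_sum, ← Finset.sum_add_distrib]
          refine Finset.sum_le_sum fun k _ => ?_
          refine (mul_le_mul_of_nonneg_left (abs_meanDemand_sub_le hd hM r z.1.1 z.2 i k z.1.2)
            (R.x_nonneg z.2 i k)).trans (le_of_eq (by ring))
      _ = d * ∫ z, (∑ k, R.x z.2 i k * (2 * r (pulls i k z.1.2) +
          excessError r (pulls i k z.1.2) (pullDeviation M d i k z.1.1 z.1.2)))
          ∂(jointLaw M R f ρ s) +
          d * ∫ z, (∑ k, R.x z.2 i k *
            excessError r (pulls i k z.1.2) (pullDeviation M d i k z.2 z.1.2))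
          ∂(jointLaw M R f ρ s) := by
          rw [integral_add (((hLj s).const_mul d).integrable _)
            (((hEj s).const_mul d).integrable _), integral_const_mul, integral_const_mul]
      _ ≤ _ := by
          refine add_le_add (le_of_eq ?_) (mul_le_mul_of_nonneg_left ?_ hd.le)
          · rw [integral_jointLaw f ρ s (hLj s)]
            simp only [hLeq]
          · rw [integral_jointLaw_swap f ρ (hpost s hsS) (hE s), integral_jointLaw_fst f ρ s (hE s)]
            calc _ ≤ ∫ _, (2 * ∑ j ∈ Finset.range J, c j) ∂f :=
                  integral_mono (((hE s).integral_kernel _).integrable _) (integrable_const _)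
                    fun θ => integral_excess_le_of_scales ρ hd hM i θ hc
                      (fun n hn x => h n (hn.trans hsS.le) x) (R.x_nonneg θ i) (R.sum_x_le_one θ i)
              _ = _ := by simp
  refine (Finset.sum_le_sum hstep).trans ?_
  have hLb : ∀ s, BoundedMeasurable fun θ : Θ =>
      ∫ h, ∑ k, offerProb ρ R i k h * (2 * r (pulls i k h) +
        excessError r (pulls i k h) (pullDeviation M d i k θ h))
        ∂(tsHistoryKernel M R ρ s θ) := by
    intro s
    have := (hL s).integral_kernel (tsHistoryKernel M R ρ s)
    simpa only [hLeq] using this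
  rw [Finset.sum_add_distrib, ← Finset.mul_sum, ← integral_finsetSum _ fun s _ =>
    (hLb s).integrable _]
  have h2 : ∫ θ, ∑ s ∈ Finset.range S, ∫ h, ∑ k, offerProb ρ R i k h * (2 * r (pulls i k h) +
        excessError r (pulls i k h) (pullDeviation M d i k θ h))
        ∂(tsHistoryKernel M R ρ s θ) ∂f ≤
      2 * (K * a + b * S) + K * (2 * ∑ l ∈ Finset.range S, c' l) := by
    calc _ ≤ ∫ _, (2 * (K * a + b * S) + K * (2 * ∑ l ∈ Finset.range S, c' l)) ∂f :=
          integral_mono ((BoundedMeasurable.sum _ fun s _ => hLb s).integrable _)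
            (integrable_const _) fun θ =>
              sum_integral_learning_le ρ hd hM i S θ hc' h' hb hr
      _ = _ := by simp
  have h3 := mul_le_mul_of_nonneg_left h2 hd.le
  simp only [Finset.sum_const, Finset.card_range, nsmul_eq_mul]
  linarith

end Joint

end EpisodicRM

namespace EpisodicRM

theorem max_zero_le_exp_div {a y : ℝ} (ha : 0 < a) : max y 0 ≤ Real.exp (a * y) / a := by
  rw [le_div_iff₀ ha]
  rcases le_total y 0 with h | h
  · rw [max_eq_right h, zero_mul]; exact (Real.exp_pos _).le
  · rw [max_eq_left h]
    linarith [Real.add_one_le_exp (a * y)]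

theorem excessError_le_expWeight {r : ℕ → ℝ} {n : ℕ} (hn : n ≠ 0) {μ : ℝ} (hμ : 0 < μ) (x : ℝ) :
    excessError r n x ≤ Real.exp (μ ^ 2 * n / 8 - μ * n * r n) / (μ * n) *
      (expWeight μ n x + expWeight (-μ) n x) := by
  have hn' : (0 : ℝ) < n := Nat.cast_pos.2 (Nat.pos_of_ne_zero hn)
  have ha : 0 < μ * n := mul_pos hμ hn'
  have h1 : expWeight μ n |x| ≤ expWeight μ n x + expWeight (-μ) n x := by
    rcases abs_choice x with h | h <;> rw [h]
    · linarith [expWeight_nonneg (-μ) n x]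
    · have : expWeight μ n (-x) = expWeight (-μ) n x := by
        simp [expWeight]
      linarith [expWeight_nonneg μ n x]
  rw [excessError, meanError, if_neg hn]
  refine (max_zero_le_exp_div ha).trans ?_
  have h2 : Real.exp (μ * n * (|x| / n - r n)) =
      Real.exp (μ ^ 2 * n / 8 - μ * n * r n) * expWeight μ n |x| := by
    rw [expWeight, ← Real.exp_add]
    congr 1
    field_simp
    ring
  rw [h2, mul_div_right_comm]
  exact mul_le_mul_of_nonneg_left h1 (by positivity)

/-- The confidence radius for the mean of `n` demands, in units of the largest demand. The
parameters stand for the number of seasons per price and the square root of `log K`. -/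
noncomputable def confidenceRadius (m L : ℝ) (n : ℕ) : ℝ :=
  if n = 0 then 1 else 2 * (√(√m) / √(√n) ^ 3) + L / (2 * √n)

theorem excessError_zero (m L x : ℝ) : excessError (confidenceRadius m L) 0 x = 0 := by
  simp [excessError, meanError, confidenceRadius]

theorem sqrt_sqrt_pow_four {x : ℝ} (hx : 0 ≤ x) : √(√x) ^ 4 = x := by
  calc √(√x) ^ 4 = (√(√x) ^ 2) ^ 2 := by ring
    _ = x := by rw [Real.sq_sqrt (Real.sqrt_nonneg _), Real.sq_sqrt hx]

theorem one_div_cube_le (n : ℕ) :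
    1 / √(√((n + 1 : ℕ) : ℝ)) ^ 3 ≤ 4 * √(√((n + 1 : ℕ) : ℝ)) - 4 * √(√(n : ℝ)) := by
  set u := √(√((n + 1 : ℕ) : ℝ)) with hu
  set v := √(√(n : ℝ)) with hv
  have hu4 : u ^ 4 = n + 1 := by
    rw [hu, sqrt_sqrt_pow_four (Nat.cast_nonneg _)]; push_cast; ring
  have hv4 : v ^ 4 = n := sqrt_sqrt_pow_four (Nat.cast_nonneg _)
  have hv0 : 0 ≤ v := Real.sqrt_nonneg _
  have hu0 : 0 < u := Real.sqrt_pos.2 (Real.sqrt_pos.2 (by positivity))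
  have huv : v ≤ u := Real.sqrt_le_sqrt (Real.sqrt_le_sqrt (by simp))
  rw [div_le_iff₀ (by positivity)]
  have h1 : u ^ 2 * v ≤ u ^ 3 := by nlinarith [sq_nonneg u]
  have h2 : u * v ^ 2 ≤ u ^ 3 := by nlinarith [mul_nonneg hu0.le hv0]
  have h3 : v ^ 3 ≤ u ^ 3 := pow_le_pow_left₀ hv0 huv 3
  have h4 : (u - v) * (u ^ 3 + u ^ 2 * v + u * v ^ 2 + v ^ 3) = 1 := by
    linear_combination hu4 - hv4
  nlinarith [mul_le_mul_of_nonneg_left (show u ^ 3 + u ^ 2 * v + u * v ^ 2 + v ^ 3 ≤ 4 * u ^ 3 by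
    linarith) (sub_nonneg.2 huv)]

theorem one_div_sqrt_le (n : ℕ) :
    1 / √((n + 1 : ℕ) : ℝ) ≤ 2 * √((n + 1 : ℕ) : ℝ) - 2 * √(n : ℝ) := by
  set u := √((n + 1 : ℕ) : ℝ) with hu
  set v := √(n : ℝ) with hv
  have hu2 : u ^ 2 = n + 1 := by rw [hu, Real.sq_sqrt (Nat.cast_nonneg _)]; push_cast; ring
  have hv2 : v ^ 2 = n := Real.sq_sqrt (Nat.cast_nonneg _)
  have hu0 : 0 < u := Real.sqrt_pos.2 (by positivity)
  rw [div_le_iff₀ hu0]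
  nlinarith [sq_nonneg (u - v)]

theorem sum_confidenceRadius_le_aux {m L : ℝ} (hL : 0 ≤ L) (n : ℕ) :
    ∑ l ∈ Finset.range (n + 1), confidenceRadius m L l ≤
      1 + 8 * √(√m) * √(√(n : ℝ)) + L * √(n : ℝ) := by
  induction n with
  | zero => simp [confidenceRadius]
  | succ n ih =>
    rw [Finset.sum_range_succ]
    have h1 := mul_le_mul_of_nonneg_left (one_div_cube_le n) (Real.sqrt_nonneg (√m))
    have h2 := mul_le_mul_of_nonneg_left (one_div_sqrt_le n) hL
    have h3 : confidenceRadius m L (n + 1) = 2 * (√(√m) * (1 / √(√((n + 1 : ℕ) : ℝ)) ^ 3)) +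
        L * (1 / √((n + 1 : ℕ) : ℝ)) / 2 := by
      rw [confidenceRadius, if_neg (Nat.succ_ne_zero n)]
      ring
    rw [h3]
    linarith

theorem sum_confidenceRadius_le {m L : ℝ} (hm : 0 < m) (hL : 0 ≤ L) (n : ℕ) :
    ∑ l ∈ Finset.range n, confidenceRadius m L l ≤
      (1 + 6 * √m + L * √m / 2) + (2 + L / 2) / √m * n := by
  have hm0 : 0 < √m := Real.sqrt_pos.2 hm
  cases n with
  | zero => simp only [Finset.range_zero, Finset.sum_empty]; positivity
  | succ n =>
    refine (sum_confidenceRadius_le_aux hL n).trans ?_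
    have hm4 : 0 < √(√m) := Real.sqrt_pos.2 hm0
    set q := √(√m) with hq
    set v := √(√(n : ℝ)) with hv
    have hv0 : 0 ≤ v := Real.sqrt_nonneg _
    have hv2 : √(n : ℝ) = v ^ 2 := (Real.sq_sqrt (Real.sqrt_nonneg _)).symm
    have hq2 : √m = q ^ 2 := (Real.sq_sqrt hm0.le).symm
    have hv4 : v ^ 4 = n := sqrt_sqrt_pow_four (Nat.cast_nonneg _)
    rw [hv2, hq2]
    push_cast
    rw [← hv4]
    have h1 : 8 * q * v ≤ 6 * q ^ 2 + 2 / q ^ 2 * v ^ 4 := by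
      have : 6 * q ^ 2 + 2 / q ^ 2 * v ^ 4 - 8 * q * v =
          2 / q ^ 2 * ((v - q) ^ 2 * ((v + q) ^ 2 + 2 * q ^ 2)) := by
        field_simp
        ring
      have h2 : 0 ≤ 2 / q ^ 2 * ((v - q) ^ 2 * ((v + q) ^ 2 + 2 * q ^ 2)) := by positivity
      linarith
    have h2 : v ^ 2 ≤ q ^ 2 / 2 + 1 / 2 / q ^ 2 * v ^ 4 := by
      have : q ^ 2 / 2 + 1 / 2 / q ^ 2 * v ^ 4 - v ^ 2 = 1 / 2 / q ^ 2 * (v ^ 2 - q ^ 2) ^ 2 := by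
        field_simp
        ring
      have h2 : 0 ≤ 1 / 2 / q ^ 2 * (v ^ 2 - q ^ 2) ^ 2 := by positivity
      linarith
    have h3 := mul_le_mul_of_nonneg_left h2 hL
    have h4 : 0 ≤ (2 + L / 2) / q ^ 2 := by positivity
    have h5 : (2 + L / 2) / q ^ 2 * v ^ 4 = 2 / q ^ 2 * v ^ 4 + L * (1 / 2 / q ^ 2 * v ^ 4) := by
      ring
    linarith

theorem sum_min_le {g : ℝ} (hg : 1 ≤ g) (J : ℕ) :
    ∑ j ∈ Finset.range J, min (1 / (2 : ℝ) ^ j) (2 ^ j / g ^ 2) ≤ 3 / g := by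
  have hg0 : 0 < g := by linarith
  have key : (2 ^ J ≤ 2 * g →
        ∑ j ∈ Finset.range J, min (1 / (2 : ℝ) ^ j) (2 ^ j / g ^ 2) ≤ 2 ^ J / g ^ 2) ∧
      (2 * g < 2 ^ J →
        ∑ j ∈ Finset.range J, min (1 / (2 : ℝ) ^ j) (2 ^ j / g ^ 2) ≤ 3 / g - 2 / 2 ^ J) := by
    induction J with
    | zero =>
      refine ⟨fun _ => ?_, fun h => ?_⟩
      · simp; positivity
      · exfalso; rw [pow_zero] at h; linarith
    | succ J ih =>
      rw [Finset.sum_range_succ]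
      have ht : (0 : ℝ) < 2 ^ J := by positivity
      have hmin1 := min_le_left (1 / (2 : ℝ) ^ J) (2 ^ J / g ^ 2)
      have hmin2 := min_le_right (1 / (2 : ℝ) ^ J) (2 ^ J / g ^ 2)
      rw [pow_succ]
      set t : ℝ := 2 ^ J
      have e1 : 2 / (t * 2) = 1 / t := by field_simp
      have e2 : t * 2 / g ^ 2 = t / g ^ 2 + t / g ^ 2 := by ring
      have e3 : 2 / t = 1 / t + 1 / t := by ring
      refine ⟨fun h => ?_, fun h => ?_⟩
      · have := ih.1 (by linarith)
        linarith
      · rcases le_or_gt t (2 * g) with h' | h'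
        · have h1 := ih.1 h'
          have h2 : t / g ^ 2 + 2 / t ≤ 3 / g := by
            rw [div_add_div _ _ (by positivity) (by positivity),
              div_le_div_iff₀ (by positivity) (by positivity)]
            nlinarith [mul_nonneg (sub_nonneg.2 h') (show 0 ≤ t - g by linarith),
              mul_nonneg hg0.le (mul_nonneg (sub_nonneg.2 h') (show 0 ≤ t - g by linarith))]
          linarith
        · have := ih.2 h'
          linarith
  rcases le_or_gt ((2 : ℝ) ^ J) (2 * g) with h | h
  · refine (key.1 h).trans ?_
    rw [div_le_div_iff₀ (by positivity) hg0]
    nlinarith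
  · have := key.2 h
    have h0 : (0 : ℝ) ≤ 2 / 2 ^ J := by positivity
    linarith

theorem exp_neg_two_mul_le {z : ℝ} (hz : 0 < z) : Real.exp (-(2 * z)) ≤ 3 / 2 / z ^ 4 := by
  have h := Real.pow_div_factorial_le_exp (2 * z) (by positivity) 4
  have h4 : ((Nat.factorial 4 : ℕ) : ℝ) = 24 := by norm_num [Nat.factorial]
  rw [h4] at h
  rw [Real.exp_neg, inv_le_comm₀ (Real.exp_pos _) (by positivity)]
  refine le_trans (le_of_eq ?_) h
  field_simp
  norm_num

theorem excessError_le_scales {m L : ℝ} (hm : 0 < m) (hL : 0 ≤ L) {n J : ℕ} (hn : n < J) (x : ℝ) :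
    excessError (confidenceRadius m L) n x ≤ ∑ j ∈ Finset.range J,
      3 * min (1 / (2 : ℝ) ^ j) (2 ^ j / m) *
        (expWeight (1 / 2 ^ j) n x + expWeight (-(1 / 2 ^ j)) n x) := by
  have hterm : ∀ j ∈ Finset.range J, 0 ≤ 3 * min (1 / (2 : ℝ) ^ j) (2 ^ j / m) *
        (expWeight (1 / 2 ^ j) n x + expWeight (-(1 / 2 ^ j)) n x) := fun j _ =>
    mul_nonneg (mul_nonneg (by norm_num) (le_min (by positivity) (by positivity)))
      (add_nonneg (expWeight_nonneg _ _ _) (expWeight_nonneg _ _ _))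
  by_cases h0 : n = 0
  · have h1 : excessError (confidenceRadius m L) n x = 0 := by rw [h0, excessError_zero]
    rw [h1]
    exact Finset.sum_nonneg hterm
  set j := Nat.log 4 n with hj
  have hjJ : j ∈ Finset.range J := Finset.mem_range.2 ((Nat.log_le_self 4 n).trans_lt hn)
  refine le_trans ?_ (Finset.single_le_sum hterm hjJ)
  have hlow : ((2 : ℝ) ^ j) ^ 2 ≤ n := by
    rw [← pow_mul, mul_comm, pow_mul]
    exact_mod_cast (Nat.pow_log_le_self 4 h0)
  have hup : (n : ℝ) ≤ 4 * ((2 : ℝ) ^ j) ^ 2 := by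
    have h1 : n < 4 ^ (j + 1) := Nat.lt_pow_succ_log_self (by norm_num) n
    have h2 : (n : ℝ) < 4 ^ (j + 1) := by exact_mod_cast h1
    rw [← pow_mul, mul_comm j, pow_mul]
    norm_num
    rw [pow_succ] at h2
    linarith
  have ht : (0 : ℝ) < 2 ^ j := by positivity
  set t : ℝ := 2 ^ j
  have hn' : (0 : ℝ) < n := Nat.cast_pos.2 (Nat.pos_of_ne_zero h0)
  refine (excessError_le_expWeight h0 (μ := 1 / t) (by positivity) x).trans ?_
  refine mul_le_mul_of_nonneg_right ?_
    (add_nonneg (expWeight_nonneg _ _ _) (expWeight_nonneg _ _ _))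
  have hm0 : 0 < √m := Real.sqrt_pos.2 hm
  have hm4 : 0 < √(√m) := Real.sqrt_pos.2 hm0
  have hq4 : √(√m) ^ 4 = m := sqrt_sqrt_pow_four hm.le
  have hv4 : √(√(n : ℝ)) ^ 4 = n := sqrt_sqrt_pow_four hn'.le
  have hv0 : 0 < √(√(n : ℝ)) := Real.sqrt_pos.2 (Real.sqrt_pos.2 hn')
  have hs0 : 0 < √t := Real.sqrt_pos.2 ht
  have hst : √t ^ 2 = t := Real.sq_sqrt ht.le
  have hsv : √t ≤ √(√(n : ℝ)) := Real.sqrt_le_sqrt (Real.le_sqrt_of_sq_le hlow)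
  set q := √(√m)
  set v := √(√(n : ℝ))
  set w := √t
  have hr : 2 * (q / v ^ 3) ≤ confidenceRadius m L n := by
    rw [confidenceRadius, if_neg h0]
    exact le_add_of_nonneg_right (by positivity)
  have hz : 2 * (q / w) ≤ 1 / t * n * confidenceRadius m L n := by
    calc 2 * (q / w) ≤ 2 * (q * v / w ^ 2) := by
          have : q / w = q * w / w ^ 2 := by field_simp
          rw [this]
          gcongr
      _ = 1 / t * n * (2 * (q / v ^ 3)) := by
          rw [hst, ← hv4]
          field_simp
      _ ≤ _ := mul_le_mul_of_nonneg_left hr (by positivity)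
  have hexp : (1 / t) ^ 2 * n / 8 ≤ 1 / 2 := by
    rw [div_pow, one_pow, one_div_mul_eq_div, div_div, div_le_div_iff₀ (by positivity) two_pos]
    linarith
  have hhalf : Real.exp (1 / 2) ≤ 2 := by
    have h1 : Real.exp (1 / 2) ^ 2 = Real.exp 1 := by rw [← Real.exp_nat_mul]; norm_num
    have h2 := Real.exp_one_lt_d9
    nlinarith [Real.exp_pos (1 / 2)]
  have hE : Real.exp ((1 / t) ^ 2 * n / 8 - 1 / t * n * confidenceRadius m L n) ≤
      2 * Real.exp (-(2 * (q / w))) := by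
    calc _ ≤ Real.exp (1 / 2 + -(2 * (q / w))) := Real.exp_le_exp.2 (by linarith)
      _ ≤ _ := by rw [Real.exp_add]; gcongr
  have hpre : 1 / (1 / t * n) ≤ 1 / t := by
    apply one_div_le_one_div_of_le ht
    rw [one_div_mul_eq_div, le_div_iff₀ ht]
    linarith
  calc _ = Real.exp ((1 / t) ^ 2 * n / 8 - 1 / t * n * confidenceRadius m L n) *
        (1 / (1 / t * n)) := by ring
    _ ≤ (2 * Real.exp (-(2 * (q / w)))) * (1 / t) := by gcongr
    _ ≤ 3 * min (1 / t) (t / m) := by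
        rw [mul_min_of_nonneg _ _ (by norm_num : (0 : ℝ) ≤ 3)]
        refine le_min ?_ ?_
        · have : Real.exp (-(2 * (q / w))) ≤ 1 := Real.exp_le_one_iff.2 (by
            have : 0 < q / w := by positivity
            linarith)
          have h1 : 0 < 1 / t := by positivity
          nlinarith
        · have h1 := exp_neg_two_mul_le (z := q / w) (by positivity)
          have h2 : (q / w) ^ 4 = m / t ^ 2 := by rw [div_pow, hq4, ← hst]; ring
          rw [h2] at h1
          calc _ ≤ (2 * (3 / 2 / (m / t ^ 2))) * (1 / t) := by gcongr
            _ = 3 * (t / m) := by field_simp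

theorem excessError_le_offered {m L : ℝ} (hL : 0 < L) {n : ℕ} (x : ℝ) :
    excessError (confidenceRadius m L) n x ≤
      Real.exp (-(L ^ 2 / 2)) / (2 * L) * (1 / √(n : ℝ)) *
        (expWeight (2 * L / √(n : ℝ)) n x + expWeight (-(2 * L / √(n : ℝ))) n x) := by
  by_cases h0 : n = 0
  · subst h0
    rw [excessError_zero]
    simp
  have hn' : (0 : ℝ) < n := Nat.cast_pos.2 (Nat.pos_of_ne_zero h0)
  have hs : 0 < √(n : ℝ) := Real.sqrt_pos.2 hn'
  have hs2 : (n : ℝ) = √(n : ℝ) ^ 2 := (Real.sq_sqrt hn'.le).symm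
  refine (excessError_le_expWeight h0 (μ := 2 * L / √(n : ℝ)) (by positivity) x).trans ?_
  refine mul_le_mul_of_nonneg_right ?_
    (add_nonneg (expWeight_nonneg _ _ _) (expWeight_nonneg _ _ _))
  have hr : L / (2 * √(n : ℝ)) ≤ confidenceRadius m L n := by
    rw [confidenceRadius, if_neg h0]
    exact le_add_of_nonneg_left (by positivity)
  have h1 : (2 * L / √(n : ℝ)) * n = 2 * L * √(n : ℝ) := by
    nth_rewrite 2 [hs2]
    field_simp
  have h2 : (2 * L / √(n : ℝ)) ^ 2 * n / 8 = L ^ 2 / 2 := by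
    nth_rewrite 2 [hs2]
    field_simp
    norm_num
  rw [h1, h2]
  have h3 : L ^ 2 ≤ 2 * L * √(n : ℝ) * confidenceRadius m L n := by
    calc L ^ 2 = 2 * L * √(n : ℝ) * (L / (2 * √(n : ℝ))) := by field_simp
      _ ≤ _ := by gcongr
  calc _ ≤ Real.exp (-(L ^ 2 / 2)) / (2 * L * √(n : ℝ)) := by
        gcongr
        linarith
    _ = _ := by field_simp

theorem sum_one_div_sqrt_le (S : ℕ) :
    ∑ l ∈ Finset.range S, 1 / √(l : ℝ) ≤ 2 * √(S : ℝ) := by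
  cases S with
  | zero => simp
  | succ S =>
    have h : ∑ l ∈ Finset.range (S + 1), 1 / √(l : ℝ) ≤ 2 * √(S : ℝ) := by
      induction S with
      | zero => simp
      | succ S ih =>
        rw [Finset.sum_range_succ]
        linarith [one_div_sqrt_le S]
    refine h.trans ?_
    have : √(S : ℝ) ≤ √((S + 1 : ℕ) : ℝ) := Real.sqrt_le_sqrt (by simp)
    linarith

/-- The constants of the bound on the estimation error add up to at most `54`. -/
theorem error_constants_le {K S : ℕ} (hK : 2 ≤ K) (hS : 4 * K ≤ S) :
    2 * (K * (1 + 6 * √((S : ℝ) / K) + √(Real.log K) * √((S : ℝ) / K) / 2) +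
        (2 + √(Real.log K) / 2) / √((S : ℝ) / K) * S) +
      K * (2 * ∑ l ∈ Finset.range S,
        Real.exp (-(√(Real.log K) ^ 2 / 2)) / (2 * √(Real.log K)) * (1 / √(l : ℝ))) +
      S * (2 * ∑ j ∈ Finset.range (S + 1), 3 * min (1 / (2 : ℝ) ^ j) (2 ^ j / ((S : ℝ) / K))) ≤
      54 * √(S * K * Real.log K) := by
  have hK0 : (0 : ℝ) < K := by exact_mod_cast (by omega : 0 < K)
  have hS0 : (0 : ℝ) < S := by exact_mod_cast (by omega : 0 < S)
  have hS4 : (4 : ℝ) * K ≤ S := by exact_mod_cast hS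
  have hlog : 0.64 ≤ Real.log K := by
    have h1 := Real.log_two_gt_d9
    have h2 : Real.log 2 ≤ Real.log K := Real.log_le_log two_pos (by exact_mod_cast hK)
    linarith
  have hm1 : 1 ≤ √((S : ℝ) / K) := Real.one_le_sqrt.2 (by rw [le_div_iff₀ hK0]; linarith)
  have hlog0 : 0 ≤ Real.log K := by linarith
  rw [Real.sqrt_mul (by positivity)]
  have hL : 0.8 ≤ √(Real.log K) := Real.le_sqrt_of_sq_le (by norm_num at hlog ⊢; linarith)
  have hLs : √(Real.log K) ^ 2 = Real.log K := Real.sq_sqrt hlog0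
  have hexp : Real.exp (-(√(Real.log K) ^ 2 / 2)) = 1 / √(K : ℝ) := by
    rw [hLs, Real.exp_neg, one_div, Real.sqrt_eq_rpow, Real.rpow_def_of_pos hK0]
    congr 2
    ring
  rw [hexp]
  set L := √(Real.log K)
  have hk : 0 < √(K : ℝ) := Real.sqrt_pos.2 hK0
  have hs : 0 < √(S : ℝ) := Real.sqrt_pos.2 hS0
  have hk2 : √(K : ℝ) ^ 2 = K := Real.sq_sqrt hK0.le
  have hs2 : √(S : ℝ) ^ 2 = S := Real.sq_sqrt hS0.le
  have hg2 : (S : ℝ) / K = √((S : ℝ) / K) ^ 2 := (Real.sq_sqrt (by positivity)).symm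
  have hg : √((S : ℝ) / K) = √(S : ℝ) / √(K : ℝ) := Real.sqrt_div hS0.le _
  have hQ : √((S : ℝ) * K) = √(S : ℝ) * √(K : ℝ) := Real.sqrt_mul hS0.le _
  have hmin := sum_min_le hm1 (S + 1)
  rw [← hg2] at hmin
  rw [← Finset.mul_sum, ← Finset.mul_sum]
  have hsum := sum_one_div_sqrt_le S
  rw [hg] at hmin ⊢
  rw [hQ]
  set k := √(K : ℝ)
  set s := √(S : ℝ)
  have hks : 2 * k ≤ s := by
    refine Real.le_sqrt_of_sq_le ?_
    rw [mul_pow, hk2]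
    linarith
  have hL0 : 0 < L := by linarith
  have t1 : (K : ℝ) * (1 + 6 * (s / k) + L * (s / k) / 2) = k ^ 2 + 6 * (s * k) + L * (s * k) / 2 := by
    rw [← hk2]; field_simp
  have t2 : (2 + L / 2) / (s / k) * S = (2 + L / 2) * (s * k) := by
    rw [← hs2]; field_simp
  have t3 : (K : ℝ) * (2 * (1 / k / (2 * L) * ∑ l ∈ Finset.range S, 1 / √(l : ℝ))) ≤
      2 / L * (s * k) := by
    calc _ ≤ (K : ℝ) * (2 * (1 / k / (2 * L) * (2 * s))) := by gcongr
      _ = _ := by rw [← hk2]; field_simp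
  have t4 : (S : ℝ) * (2 * (3 * ∑ j ∈ Finset.range (S + 1),
      min (1 / (2 : ℝ) ^ j) (2 ^ j / ((S : ℝ) / K)))) ≤ 18 * (s * k) := by
    calc _ ≤ (S : ℝ) * (2 * (3 * (3 / (s / k)))) := by gcongr
      _ = _ := by rw [← hs2]; field_simp; norm_num
  have t5 : k ^ 2 ≤ s * k / 2 := by nlinarith only [hks, hk]
  have hsk : 0 < s * k := mul_pos hs hk
  have t6 : 2 / L ≤ 4 * L := by
    rw [div_le_iff₀ hL0]; nlinarith only [hL]
  have t7 := mul_le_mul_of_nonneg_right t6 hsk.le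
  have t8 := mul_le_mul_of_nonneg_left (show 1 ≤ 5 / 4 * L by linarith) hsk.le
  rw [t1, t2]
  linarith

end EpisodicRM

namespace EpisodicRM

variable {Θ : Type*} [MeasurableSpace Θ] {K T : ℕ} {M : Model Θ K T} {R : LPSolver M} {d : ℝ}

theorem demandBounded_of_finite_support
    (h : ∀ (t : Fin T) (k : Fin K) (θ : Θ), ∃ F : Finset ℝ,
      (F : Set ℝ) ⊆ Set.Icc 0 d ∧ M.demand t k θ (F : Set ℝ)ᶜ = 0) : M.DemandBounded d := by
  intro t k θ
  obtain ⟨F, hF, h0⟩ := h t k θ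
  have h1 : ∀ᵐ y ∂(M.demand t k θ), y ∈ (F : Set ℝ) := mem_ae_iff.2 h0
  exact h1.mono fun y hy => hF hy

/-- The expected revenue of a season, given the true and the sampled parameter. -/
noncomputable def seasonRevenue (R : LPSolver M) (d : ℝ) (p : Θ × Θ) : ℝ :=
  ∫ q, M.clipRevenue d T q ∂(M.seasonKernel R.policy T le_rfl p)

theorem boundedMeasurable_seasonRevenue (R : LPSolver M) (hd : 0 ≤ d) :
    BoundedMeasurable (seasonRevenue R d) :=
  ((M.boundedMeasurable_clipRevenue hd T).comp measurable_snd).integral_kernel _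

theorem boundedMeasurable_lpValue (R : LPSolver M) (hd : 0 ≤ d) (hM : M.DemandBounded d) :
    BoundedMeasurable fun θ => M.lpValue θ (R.x θ) :=
  .sum _ fun i _ => .sum _ fun k _ => ((R.boundedMeasurable_x i k).mul
    (Model.boundedMeasurable_meanDemand hd hM i k)).mul (.const _)

theorem boundedMeasurable_optRevenue (hd : 0 ≤ d) (hM : M.DemandBounded d) :
    BoundedMeasurable M.optRevenue := by
  obtain ⟨π₀, h⟩ := M.exists_optRevenue_eq hd hM
  have h1 := (((M.boundedMeasurable_clipRevenue hd T).comp measurable_snd).integral_kernel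
    (M.seasonKernel π₀ T le_rfl)).comp (measurable_id.prodMk measurable_id)
  convert h1 using 1
  exact funext h

theorem optRevenue_le_lpValue (R : LPSolver M) (hd : 0 ≤ d) (hM : M.DemandBounded d) (θ : Θ) :
    M.optRevenue θ ≤ M.lpValue θ (R.x θ) := by
  obtain ⟨π₀, h⟩ := M.exists_optRevenue_eq hd hM
  rw [h]
  exact Model.integral_clipRevenue_le_lpValue hd hM π₀ θ (R.optimal θ)

theorem integral_sum_revenue (ρ : (s : ℕ) → Kernel (History K T s) Θ) (hd : 0 ≤ d)
    (hM : M.DemandBounded d) (S : ℕ) (θ : Θ) :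
    ∫ h, ∑ s, M.revenue T (h s) ∂(tsHistoryKernel M R ρ S θ) =
      ∫ h, ∑ s, M.clipRevenue d T (h s) ∂(tsHistoryKernel M R ρ S θ) := by
  refine integral_congr_ae ?_
  filter_upwards [ae_tsHistoryKernel ρ hd hM S θ] with h hh
  exact Finset.sum_congr rfl fun s _ => by rw [Model.clipRevenue, hh s]

section Revenue

variable (ρ : (s : ℕ) → Kernel (History K T s) Θ) [hρ : ∀ s, IsMarkovKernel (ρ s)]

theorem boundedMeasurable_sum_clipRevenue (hd : 0 ≤ d) (S : ℕ) :
    BoundedMeasurable fun h : History K T S => ∑ s, M.clipRevenue d T (h s) :=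
  .sum _ fun s _ => (M.boundedMeasurable_clipRevenue hd T).comp (measurable_pi_apply s)

theorem integral_sum_clipRevenue (hd : 0 ≤ d) (S : ℕ) (θ : Θ) :
    ∫ h, ∑ s, M.clipRevenue d T (h s) ∂(tsHistoryKernel M R ρ S θ) =
      ∑ s ∈ Finset.range S, ∫ h, ∫ θ', seasonRevenue R d (θ, θ') ∂(ρ s h)
        ∂(tsHistoryKernel M R ρ s θ) := by
  induction S with
  | zero => simp
  | succ S ih =>
    have hV := boundedMeasurable_seasonRevenue R hd
    have hV1 : BoundedMeasurable fun θ' => seasonRevenue R d (θ, θ') :=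
      hV.comp measurable_prodMk_left
    have hV2 : BoundedMeasurable fun h : History K T S =>
        ∫ θ', seasonRevenue R d (θ, θ') ∂(ρ S h) :=
      (hV1.comp measurable_snd).integral_kernel (ρ S)
    rw [integral_tsHistoryKernel_succ ρ θ (boundedMeasurable_sum_clipRevenue hd (S + 1)),
      Finset.sum_range_succ, ← ih, ← integral_add
        ((boundedMeasurable_sum_clipRevenue hd S).integrable _) (hV2.integrable _)]
    refine integral_congr_ae (.of_forall fun h => ?_)
    have h1 : ∀ θ', ∫ q, (∑ j, M.clipRevenue d T (h j) + M.clipRevenue d T q)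
        ∂(M.seasonKernel R.policy T le_rfl (θ, θ')) =
        ∑ j, M.clipRevenue d T (h j) + seasonRevenue R d (θ, θ') := by
      intro θ'
      rw [integral_add (integrable_const _)
        ((M.boundedMeasurable_clipRevenue hd T).integrable _)]
      simp [seasonRevenue]
    simp only [Fin.sum_univ_castSucc, append_castSucc, append_last, h1]
    rw [integral_add (integrable_const _) (hV1.integrable _)]
    simp

variable (f : Measure Θ) [IsProbabilityMeasure f]

theorem integral_integral_sum_clipRevenue (hd : 0 ≤ d) (S : ℕ) :
    ∫ θ, ∫ h, ∑ s, M.clipRevenue d T (h s) ∂(tsHistoryKernel M R ρ S θ) ∂f =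
      ∑ s ∈ Finset.range S, ∫ z, seasonRevenue R d (z.1.1, z.2) ∂(jointLaw M R f ρ s) := by
  have hV := boundedMeasurable_seasonRevenue R hd
  have hVj : ∀ s, BoundedMeasurable fun z : (Θ × History K T s) × Θ =>
      seasonRevenue R d (z.1.1, z.2) := fun s => hV.comp (by fun_prop)
  have hVb : ∀ s, BoundedMeasurable fun θ => ∫ h, ∫ θ', seasonRevenue R d (θ, θ') ∂(ρ s h)
      ∂(tsHistoryKernel M R ρ s θ) := fun s =>
    ((hVj s).integral_kernel ((ρ s).comap Prod.snd measurable_snd)).integral_kernel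
      (tsHistoryKernel M R ρ s)
  simp only [integral_sum_clipRevenue ρ hd]
  rw [integral_finsetSum _ fun s _ => (hVb s).integrable _]
  exact Finset.sum_congr rfl fun s _ => (integral_jointLaw f ρ s (hVj s)).symm

/-- The Bayesian regret of one season. -/
theorem integral_optRevenue_sub_le (hd : 0 ≤ d) (hM : M.DemandBounded d) {s : ℕ}
    (hpost : IsPosterior f (tsHistoryKernel M R ρ s) (ρ s)) :
    ∫ θ, M.optRevenue θ ∂f - ∫ z, seasonRevenue R d (z.1.1, z.2) ∂(jointLaw M R f ρ s) ≤
      M.maxPrice * (d * √T +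
        ∑ i, ∫ z, R.demandError (z.1.1, z.2) i ∂(jointLaw M R f ρ s)) := by
  have hlp := boundedMeasurable_lpValue R hd hM
  have hlp1 : BoundedMeasurable fun z : Θ × History K T s => M.lpValue z.1 (R.x z.1) :=
    hlp.comp measurable_fst
  have hlp2 : BoundedMeasurable fun z : (Θ × History K T s) × Θ => M.lpValue z.2 (R.x z.2) :=
    hlp.comp measurable_snd
  have hVj : BoundedMeasurable fun z : (Θ × History K T s) × Θ =>
      seasonRevenue R d (z.1.1, z.2) :=
    (boundedMeasurable_seasonRevenue R hd).comp (by fun_prop)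
  have herr : BoundedMeasurable fun z : (Θ × History K T s) × Θ =>
      ∑ i, R.demandError (z.1.1, z.2) i :=
    .sum _ fun i _ => boundedMeasurable_demandError hd hM i
  have h1 : ∫ θ, M.optRevenue θ ∂f ≤ ∫ z, M.lpValue z.2 (R.x z.2) ∂(jointLaw M R f ρ s) := by
    have h2 := integral_jointLaw_swap f ρ hpost hlp1
    dsimp only at h2
    rw [h2, integral_jointLaw_fst f ρ s hlp1]
    simp only [integral_const, probReal_univ, one_smul]
    exact integral_mono ((boundedMeasurable_optRevenue hd hM).integrable _) (hlp.integrable _)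
      (optRevenue_le_lpValue R hd hM)
  calc _ ≤ ∫ z, M.lpValue z.2 (R.x z.2) ∂(jointLaw M R f ρ s) -
        ∫ z, seasonRevenue R d (z.1.1, z.2) ∂(jointLaw M R f ρ s) := by linarith
    _ = ∫ z, (M.lpValue z.2 (R.x z.2) - seasonRevenue R d (z.1.1, z.2))
        ∂(jointLaw M R f ρ s) := (integral_sub (hlp2.integrable _) (hVj.integrable _)).symm
    _ ≤ ∫ z, M.maxPrice * (d * √T + ∑ i, R.demandError (z.1.1, z.2) i)
        ∂(jointLaw M R f ρ s) :=
        integral_mono ((hlp2.sub hVj).integrable _)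
          ((((BoundedMeasurable.const (d * √T)).add herr).const_mul _).integrable _)
          fun z => R.lpValue_sub_integral_clipRevenue_le hd hM (z.1.1, z.2)
    _ = _ := by
        rw [integral_const_mul, integral_add (integrable_const _) (herr.integrable _),
          integral_finsetSum _ fun i _ => (boundedMeasurable_demandError hd hM i).integrable _]
        simp

end Revenue

end EpisodicRM

theorem theorem1 {Θ : Type*} [MeasurableSpace Θ] {K T S : ℕ} (hK : 2 ≤ K) (hS : 4 * K ≤ S)
    (M : EpisodicRM.Model Θ K T) (d : ℝ) (hd : 0 < d)
    (hsupp : ∀ (t : Fin T) (k : Fin K) (θ : Θ), ∃ F : Finset ℝ,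
      (F : Set ℝ) ⊆ Set.Icc 0 d ∧ M.demand t k θ (F : Set ℝ)ᶜ = 0)
    (f : Measure Θ) [IsProbabilityMeasure f]
    (R : EpisodicRM.LPSolver M) (A : EpisodicRM.TSEpisodic M R f S) :
    Integrable A.regret f ∧
      A.bayesRegret ≤ (⨆ k, M.price k) * d *
        (S * Real.sqrt T + 54 * T * Real.sqrt (S * K * Real.log K)) := by
  have hM := EpisodicRM.demandBounded_of_finite_support hsupp
  have hρ := A.ρ_markov
  have hopt := EpisodicRM.boundedMeasurable_optRevenue hd.le hM
  have hrev : EpisodicRM.BoundedMeasurable fun θ =>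
      ∫ h, ∑ s, M.clipRevenue d T (h s) ∂(EpisodicRM.tsHistoryKernel M R A.ρ S θ) :=
    ((EpisodicRM.boundedMeasurable_sum_clipRevenue hd.le S).comp measurable_snd).integral_kernel _
  have hreg : A.regret = fun θ => S * M.optRevenue θ -
      ∫ h, ∑ s, M.clipRevenue d T (h s) ∂(EpisodicRM.tsHistoryKernel M R A.ρ S θ) := by
    funext θ
    rw [EpisodicRM.TSEpisodic.regret, EpisodicRM.TSEpisodic.expRevenue,
      EpisodicRM.integral_sum_revenue A.ρ hd.le hM]
  refine ⟨hreg ▸ ((hopt.const_mul _).sub hrev).integrable f, ?_⟩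
  have hK0 : (0 : ℝ) < K := by exact_mod_cast (by omega : 0 < K)
  have hS0 : (0 : ℝ) < S := by exact_mod_cast (by omega : 0 < S)
  have hlog : 0 < Real.log K := Real.log_pos (by exact_mod_cast (by omega : 1 < K))
  have hL : 0 < √(Real.log K) := Real.sqrt_pos.2 hlog
  have hm : 0 < (S : ℝ) / K := div_pos hS0 hK0
  have herr : ∀ i : Fin T, ∑ s ∈ Finset.range S, ∫ z, R.demandError (z.1.1, z.2) i
      ∂(EpisodicRM.jointLaw M R f A.ρ s) ≤ d * (54 * √(S * K * Real.log K)) := by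
    intro i
    refine (EpisodicRM.sum_integral_demandError_le f A.ρ hd hM i A.posterior
      (r := EpisodicRM.confidenceRadius (S / K) √(Real.log K))
      (fun j => mul_nonneg (by norm_num) (le_min (by positivity) (by positivity)))
      (fun n => mul_nonneg (by positivity) (by positivity))
      (fun n hn x => EpisodicRM.excessError_le_scales hm hL.le (Nat.lt_succ_of_le hn) x)
      (fun n _ x => EpisodicRM.excessError_le_offered hL x)
      (by positivity) (EpisodicRM.sum_confidenceRadius_le hm hL.le)).trans ?_
    exact mul_le_mul_of_nonneg_left (EpisodicRM.error_constants_le hK hS) hd.le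
  rw [EpisodicRM.TSEpisodic.bayesRegret, hreg,
    integral_sub ((hopt.const_mul _).integrable f) (hrev.integrable f), integral_const_mul,
    EpisodicRM.integral_integral_sum_clipRevenue A.ρ f hd.le]
  calc _ = ∑ s ∈ Finset.range S, (∫ θ, M.optRevenue θ ∂f -
        ∫ z, EpisodicRM.seasonRevenue R d (z.1.1, z.2) ∂(EpisodicRM.jointLaw M R f A.ρ s)) := by
        simp [Finset.sum_sub_distrib]
    _ ≤ ∑ s ∈ Finset.range S, M.maxPrice * (d * √T + ∑ i, ∫ z, R.demandError (z.1.1, z.2) i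
        ∂(EpisodicRM.jointLaw M R f A.ρ s)) := Finset.sum_le_sum fun s hs =>
        EpisodicRM.integral_optRevenue_sub_le A.ρ f hd.le hM (A.posterior s (Finset.mem_range.1 hs))
    _ = M.maxPrice * (S * (d * √T) + ∑ i, ∑ s ∈ Finset.range S, ∫ z,
        R.demandError (z.1.1, z.2) i ∂(EpisodicRM.jointLaw M R f A.ρ s)) := by
        rw [← Finset.mul_sum, Finset.sum_add_distrib, Finset.sum_comm]
        simp
    _ ≤ M.maxPrice * (S * (d * √T) + ∑ _i : Fin T, d * (54 * √(S * K * Real.log K))) :=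
        mul_le_mul_of_nonneg_left (add_le_add_right (Finset.sum_le_sum fun i _ => herr i) _)
          M.maxPrice_nonneg
    _ = _ := by
        simp only [Finset.sum_const, Finset.card_univ, Fintype.card_fin, nsmul_eq_mul,
          EpisodicRM.Model.maxPrice]
        ring
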